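/- Let $\Omega\subset\mathbb R^2$ be a bounded connected open set with Lipschitz boundary, let $z_1<z_2$, $I=[z_1,z_2]$, and $Q=\Omega\times(z_1,z_2)$. Let $c,\sigma:\Omega\to(0,\infty)$ be measurable and bounded with bounded inverse, and let $h\in L^\infty(\Omega)$; put $\omega_\pm=\{x\in\Omega:\pm h(x)>0\}$. Let $\partial\Omega$ be partitioned into measurable parts $\Gamma_N,\Gamma_D,\Gamma_R,\Gamma_\sharp$ (each possibly empty), where $\Gamma_\sharp=\bigcup_{j=1}^n\bigl(S_j\cup(S_j+p_j)\bigr)$ for finitely many measurable sets $S_j$ and vectors $p_j\in\mathbb R^2$, and let $a\in L^\infty(\Gamma_R)$ with $a>0$ a.e. Let $\Omega\times\{z_1,z_2\}$ be partitioned into measurable sets $\Omega_D$ and $\Omega_N$. Assume that the inlet/outlet condition is Dirichlet where the flow enters, i.e. (up to null sets) \[\omega_+\times\{z_1\}\subset\Omega_D,\qquad \omega_-\times\{z_2\}\subset\Omega_D,\] and that $\Omega_D\cup\bigl((\Gamma_D\cup\Gamma_R)\times I\bigr)$ has positive surface measure (this is automatic unless $h=0$ a.e.). For a function $T_D$ on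 $\Omega_D$ let $\mathcal X(T_D)$ be the set of all $T\in H^1(Q)$ whose trace satisfies $T=0$ on $\Gamma_D\times I$, $T(x+p_j,z)=T(x,z)$ for $x\in S_j$, $z\in I$, $1\le j\le n$, and $T=T_D$ on $\Omega_D$. Let $S_N\in L^2(\Omega_N)$, and let $T_D$ be regular enough in the sense that $\mathcal X(T_D)\neq\emptyset$. Then the Graetz problem \[c\,\partial_{zz}T+\operatorname{div}(\sigma\nabla T)-h\,\partial_zT=0\ \text{ in }Q,\] with the lateral conditions $\sigma\nabla T\cdot n=0$ on $\Gamma_N\times I$, $T=0$ on $\Gamma_D\times I$, $\sigma\nabla T\cdot n+aT=0$ on $\Gamma_R\times I$, $T$ periodic on $\Gamma_\sharp\times I$ (here $\nabla$ and $\operatorname{div}$ act on the variables of $\Omega$), and the inlet/outlet conditions $T=T_D$ on $\Omega_D$, $\partial_zT=S_N$ on $\Omega_N$, has a unique weak solution, that is, there is a unique $T\in\mathcal X(T_D)$ such that for every $\varphi\in\mathcal X(0)$ \[\int_Q\bigl(c\,\partial_zT\,\partial_z\varphi+\sigma\nabla T\cdot\nabla\varphi+h\,\partial_zT\,\varphi\bigr)+\int_{\Gamma_R\times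 I}a\,T\varphi=\int_{\Omega_N\cap(\Omega\times\{z_2\})}c\,S_N\varphi-\int_{\Omega_N\cap(\Omega\times\{z_1\})}c\,S_N\varphi .\] -/

import Mathlib

open MeasureTheory Filter Topology Set
open scoped ENNReal NNReal ContDiff

namespace Graetz

/-- The plane of the cross section, with its Euclidean norm. -/
abbrev Plane : Type := EuclideanSpace ℝ (Fin 2)

/-- Points `(x, z)`: `x` in the cross-sectional plane, `z` along the axis of the cylinder.
The volume is the product (Lebesgue) measure. -/
abbrev Space : Type := Plane × ℝ

/-- Bounded connected open sets which, near each boundary point and in suitable orthonormal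
coordinates, are the strict epigraph of a Lipschitz function. -/
structure IsLipschitzDomain (Ω : Set Plane) : Prop where
  isOpen : IsOpen Ω
  isConnected : IsConnected Ω
  isBounded : Bornology.IsBounded Ω
  lipschitz_boundary : ∀ x ∈ frontier Ω,
    ∃ (L : Plane ≃ₗᵢ[ℝ] Plane) (γ : ℝ → ℝ) (K : ℝ≥0), LipschitzWith K γ ∧
      ∀ᶠ y in 𝓝 x, (y ∈ Ω ↔ γ (L y 0) < L y 1)

/-- The open cylinder `Ω × (z₁, z₂)`. -/
def cylinder (Ω : Set Plane) (z₁ z₂ : ℝ) : Set Space := Ω ×ˢ Ioo z₁ z₂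

/-- The surface measure of the boundary of the cylinder: length of `∂Ω` times `dz` on the lateral
part, and the area on each of the two end sections `Ω × {z₁}` and `Ω × {z₂}`. -/
noncomputable def boundaryMeasure (Ω : Set Plane) (z₁ z₂ : ℝ) : Measure Space :=
  ((Measure.hausdorffMeasure 1).restrict (frontier Ω)).prod (volume.restrict (Ioo z₁ z₂))
    + (volume.restrict Ω).prod (Measure.dirac z₁)
    + (volume.restrict Ω).prod (Measure.dirac z₂)

/-- `v` is the weak derivative of `u` in the direction `e` on the open set `U`. -/
def IsWeakDeriv (U : Set Space) (u v : Space → ℝ) (e : Space) : Prop :=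
  ∀ φ : Space → ℝ, ContDiff ℝ ∞ φ → HasCompactSupport φ → tsupport φ ⊆ U →
    ∫ y in U, u y * fderiv ℝ φ y e = -∫ y in U, v y * φ y

/-- An element of `H¹(Ω × (z₁, z₂))`: a square integrable function together with (representatives
of) its square integrable weak cross-sectional gradient and weak `z`-derivative. -/
structure H1 (Ω : Set Plane) (z₁ z₂ : ℝ) where
  /-- the function -/
  val : Space → ℝ
  /-- the weak gradient in the cross-sectional variables -/
  grad : Space → Plane
  /-- the weak derivative along the axis -/
  dz : Space → ℝ
  memLp_val : MemLp val 2 (volume.restrict (cylinder Ω z₁ z₂))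
  memLp_grad : MemLp grad 2 (volume.restrict (cylinder Ω z₁ z₂))
  memLp_dz : MemLp dz 2 (volume.restrict (cylinder Ω z₁ z₂))
  weak_grad : ∀ e : Plane,
    IsWeakDeriv (cylinder Ω z₁ z₂) val (fun y => inner ℝ (grad y) e) (e, 0)
  weak_dz : IsWeakDeriv (cylinder Ω z₁ z₂) val dz (0, 1)

/-- `g` is the trace of `u ∈ H¹` on the boundary of the cylinder: there are functions smooth up to
the boundary that converge to `u` in `H¹` and whose boundary values converge to `g` in `L²` of
the boundary. -/
structure HasTrace {Ω : Set Plane} {z₁ z₂ : ℝ} (u : H1 Ω z₁ z₂) (g : Space → ℝ) : Prop where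
  memLp : MemLp g 2 (boundaryMeasure Ω z₁ z₂)
  approx : ∃ ψ : ℕ → Space → ℝ, (∀ n, ContDiff ℝ ∞ (ψ n)) ∧
    Tendsto (fun n => eLpNorm (fun y => ψ n y - u.val y) 2
      (volume.restrict (cylinder Ω z₁ z₂))) atTop (𝓝 0) ∧
    Tendsto (fun n => eLpNorm (fun y => gradient (fun x => ψ n (x, y.2)) y.1 - u.grad y) 2
      (volume.restrict (cylinder Ω z₁ z₂))) atTop (𝓝 0) ∧
    Tendsto (fun n => eLpNorm (fun y => deriv (fun z => ψ n (y.1, z)) y.2 - u.dz y) 2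
      (volume.restrict (cylinder Ω z₁ z₂))) atTop (𝓝 0) ∧
    Tendsto (fun n => eLpNorm (fun y => ψ n y - g y) 2 (boundaryMeasure Ω z₁ z₂)) atTop (𝓝 0)

/-- A partition of `∂Ω` into a Neumann part `ΓN`, a Dirichlet part `ΓD`, a Robin part `ΓR` and a
periodic part. The periodic part consists of finitely many pieces `side j` and their translates
`side j + shift j`; the condition there is `T (x + shift j, z) = T (x, z)` for `x ∈ side j`.
Each of the four parts may be empty. -/
structure LateralPartition (Ω : Set Plane) where
  ΓN : Set Plane
  ΓD : Set Plane
  ΓR : Set Plane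
  /-- the number of pairs of identified pieces -/
  numPairs : ℕ
  side : Fin numPairs → Set Plane
  shift : Fin numPairs → Plane
  /-- the periodic part -/
  Γper : Set Plane
  Γper_eq : Γper = ⋃ j, (side j ∪ (fun x => x + shift j) '' side j)
  measurableSet_ΓN : MeasurableSet ΓN
  measurableSet_ΓD : MeasurableSet ΓD
  measurableSet_ΓR : MeasurableSet ΓR
  measurableSet_side : ∀ j, MeasurableSet (side j)
  disjoint_ND : Disjoint ΓN ΓD
  disjoint_NR : Disjoint ΓN ΓR
  disjoint_NP : Disjoint ΓN Γper
  disjoint_DR : Disjoint ΓD ΓR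
  disjoint_DP : Disjoint ΓD Γper
  disjoint_RP : Disjoint ΓR Γper
  cover : ΓN ∪ ΓD ∪ ΓR ∪ Γper = frontier Ω

/-- The essential lateral conditions on a trace `g`: it vanishes on `ΓD × (z₁, z₂)` and is periodic
on the periodic part. -/
def LateralEssential {Ω : Set Plane} (Γ : LateralPartition Ω) (z₁ z₂ : ℝ) (g : Space → ℝ) : Prop :=
  (∀ᵐ y ∂(boundaryMeasure Ω z₁ z₂).restrict (Γ.ΓD ×ˢ Ioo z₁ z₂), g y = 0) ∧
  ∀ j, ∀ᵐ y ∂(boundaryMeasure Ω z₁ z₂).restrict (Γ.side j ×ˢ Ioo z₁ z₂),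
    g (y.1 + Γ.shift j, y.2) = g y

/-- `T` belongs to `H¹`, with trace `g` satisfying the essential lateral conditions and equal to
`TD` on the inlet/outlet part `ΩD`. For `TD = 0` this is the space of test functions. -/
def InAffineSpace {Ω : Set Plane} {z₁ z₂ : ℝ} (Γ : LateralPartition Ω) (ΩD : Set Space)
    (TD : Space → ℝ) (T : H1 Ω z₁ z₂) (g : Space → ℝ) : Prop :=
  HasTrace T g ∧ LateralEssential Γ z₁ z₂ g ∧
    ∀ᵐ y ∂(boundaryMeasure Ω z₁ z₂).restrict ΩD, g y = TD y

/-- The regularity of the Dirichlet datum on `ΩD`: it lies in the trace space, that is, it is the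
restriction to `ΩD` of the trace of some `H¹` function which satisfies the essential lateral
conditions. -/
def IsDirichletDatum {Ω : Set Plane} (Γ : LateralPartition Ω) (z₁ z₂ : ℝ) (ΩD : Set Space)
    (TD : Space → ℝ) : Prop :=
  ∃ (G : H1 Ω z₁ z₂) (g : Space → ℝ), InAffineSpace Γ ΩD TD G g

/-- The variational form of the Graetz operator with the Robin term; `g`, `k` are the traces of
`T`, `φ`. -/
noncomputable def form {Ω : Set Plane} {z₁ z₂ : ℝ} (Γ : LateralPartition Ω)
    (c σ h a : Plane → ℝ) (T : H1 Ω z₁ z₂) (g : Space → ℝ) (φ : H1 Ω z₁ z₂) (k : Space → ℝ) : ℝ :=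
  (∫ y in cylinder Ω z₁ z₂, (c y.1 * T.dz y * φ.dz y + σ y.1 * inner ℝ (T.grad y) (φ.grad y)
      + h y.1 * T.dz y * φ.val y))
    + ∫ y in Γ.ΓR ×ˢ Ioo z₁ z₂, a y.1 * g y * k y ∂(boundaryMeasure Ω z₁ z₂)

/-- `T` is a weak solution of `c ∂_zz T + div (σ ∇T) - h ∂_z T = 0` in `Ω × (z₁, z₂)` with
`σ ∇T · n = 0` on `ΓN`, `T = 0` on `ΓD`, `σ ∇T · n + a T = 0` on `ΓR`, `T` periodic on the periodic
part, `T = TD` on `ΩD` and `∂_z T = SN` on `ΩN`. The outward normal derivative on `ΩN` is `∂_z T`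
at `z₂` and `-∂_z T` at `z₁`. -/
def IsWeakSolution {Ω : Set Plane} {z₁ z₂ : ℝ} (Γ : LateralPartition Ω) (ΩD ΩN : Set Space)
    (c σ h a : Plane → ℝ) (TD SN : Space → ℝ) (T : H1 Ω z₁ z₂) : Prop :=
  ∃ g : Space → ℝ, InAffineSpace Γ ΩD TD T g ∧
    ∀ (φ : H1 Ω z₁ z₂) (k : Space → ℝ), InAffineSpace Γ ΩD 0 φ k →
      form Γ c σ h a T g φ k =
        (∫ y in ΩN ∩ Ω ×ˢ {z₂}, c y.1 * SN y * k y ∂(boundaryMeasure Ω z₁ z₂))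
          - ∫ y in ΩN ∩ Ω ×ˢ {z₁}, c y.1 * SN y * k y ∂(boundaryMeasure Ω z₁ z₂)

/-- Bounded on `Ω`, positive, with bounded inverse (almost everywhere). -/
def IsDiffusionCoefficient (Ω : Set Plane) (f : Plane → ℝ) : Prop :=
  AEStronglyMeasurable f (volume.restrict Ω) ∧
    ∃ m M : ℝ, 0 < m ∧ ∀ᵐ x ∂volume.restrict Ω, m ≤ f x ∧ f x ≤ M

end Graetz

/-! The theorem is Lax–Milgram on the space of test functions, and the point is the coercivity of a
non-symmetric form. Since `h` does not depend on `z`, the convection term `∫ h ∂_zT T` is half the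
difference of `∫ h T²` over the two ends (`convection_eq`). A test function vanishes where the flow
enters, that is where `h > 0` at `z₁` and where `h < 0` at `z₂`, so what remains of both end terms
is nonnegative (`convection_nonneg`). The form therefore dominates the gradient energy plus the
Robin term, and a Friedrichs inequality (`cylinder_friedrichs`) bounds the function and its trace by
these.

The Friedrichs inequality is obtained without compact embeddings. `OscControlled` compares two
measures: the mean square of `F x - F y`, with `x` and `y` distributed by them, is bounded by the
energy. This relation is monotone, symmetric, additive, and transitive through a nonzero finite
measure. Near each point it follows from the fundamental theorem of calculus along segments in a
Lipschitz chart; connectedness and compactness make it global. Boundary length is carried along with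
area, so boundary values are controlled too. `cylinder_poincare` adds the axial variable by moving
one variable at a time.

A function, its derivatives and its trace form one point of the Hilbert space `DataSpace`, and
`traceData` is the closure of the points given by smooth functions. This matches `HasTrace`, so
neither a trace theorem nor a density theorem enters: identities and inequalities are checked on
smooth functions and pass to the closure. The Dirichlet datum is removed by subtracting a lifting,
and uniqueness is coercivity applied to the difference of two solutions. -/

namespace Graetz

/-! ### Mean square oscillation between two measures -/

section Oscillation

variable {X ι : Type*} [MeasurableSpace X]

/-- The mean square oscillation of the functions `F i` between the measures `μ` and `ν` is bounded
by the energies `E i`, up to a constant. -/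
def OscControlled (F : ι → X → ℝ) (E : ι → ℝ≥0∞) (μ ν : Measure X) : Prop :=
  ∃ C : ℝ≥0, ∀ i, ∫⁻ x, ∫⁻ y, ‖F i x - F i y‖ₑ ^ 2 ∂ν ∂μ ≤ C * E i

theorem ennreal_add_sq_le (a b : ℝ≥0∞) : (a + b) ^ 2 ≤ 2 * (a ^ 2 + b ^ 2) := by
  by_cases ha : a = ⊤
  · simp [ha, ENNReal.mul_top]
  by_cases hb : b = ⊤
  · simp [hb, ENNReal.mul_top]
  lift a to ℝ≥0 using ha
  lift b to ℝ≥0 using hb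
  exact_mod_cast add_sq_le (a := a) (b := b)

theorem enorm_sub_sq_le (a b c : ℝ) : ‖a - c‖ₑ ^ 2 ≤ 2 * (‖a - b‖ₑ ^ 2 + ‖b - c‖ₑ ^ 2) := by
  refine le_trans ?_ (ennreal_add_sq_le _ _)
  gcongr
  calc ‖a - c‖ₑ = ‖(a - b) + (b - c)‖ₑ := by ring_nf
    _ ≤ _ := enorm_add_le _ _

theorem measurable_enorm_sub_sq {f : X → ℝ} (hf : Measurable f) :
    Measurable (fun p : X × X => ‖f p.1 - f p.2‖ₑ ^ 2) := by fun_prop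

namespace OscControlled

variable {F : ι → X → ℝ} {E : ι → ℝ≥0∞} {μ μ' ν ν' κ : Measure X}

theorem mono (h : OscControlled F E μ ν) (hμ : μ' ≤ μ) (hν : ν' ≤ ν) : OscControlled F E μ' ν' := by
  obtain ⟨C, hC⟩ := h
  exact ⟨C, fun i => (lintegral_mono' hμ fun x => lintegral_mono' hν le_rfl).trans (hC i)⟩

theorem symm [SFinite μ] [SFinite ν] (hF : ∀ i, Measurable (F i)) (h : OscControlled F E μ ν) :
    OscControlled F E ν μ := by
  obtain ⟨C, hC⟩ := h
  refine ⟨C, fun i => ?_⟩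
  rw [lintegral_lintegral_swap (measurable_enorm_sub_sq (hF i)).aemeasurable]
  simpa only [enorm_sub_rev] using hC i

theorem zero_left : OscControlled F E 0 ν := ⟨0, fun i => by simp⟩

theorem add_left (h : OscControlled F E μ ν) (h' : OscControlled F E μ' ν) :
    OscControlled F E (μ + μ') ν := by
  obtain ⟨C, hC⟩ := h
  obtain ⟨C', hC'⟩ := h'
  refine ⟨C + C', fun i => ?_⟩
  rw [lintegral_add_measure, ENNReal.coe_add, add_mul]
  exact add_le_add (hC i) (hC' i)

/-- Insert an intermediate point `y` between `x` and `z`, average over `y` with respect to `ν`, and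
divide by the mass of `ν`. This is why `ν` must be nonzero. -/
theorem trans [IsFiniteMeasure μ] [IsFiniteMeasure ν] [IsFiniteMeasure κ]
    (hF : ∀ i, Measurable (F i)) (hν : ν ≠ 0)
    (h : OscControlled F E μ ν) (h' : OscControlled F E ν κ) : OscControlled F E μ κ := by
  obtain ⟨C, hC⟩ := h
  obtain ⟨C', hC'⟩ := h'.symm hF
  have hν0 : ν univ ≠ 0 := by simpa using hν
  have hνt : ν univ ≠ ⊤ := measure_ne_top _ _
  have key : ∀ i, ν univ * ∫⁻ x, ∫⁻ z, ‖F i x - F i z‖ₑ ^ 2 ∂κ ∂μ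
      ≤ (2 * (κ univ * C + C' * μ univ)) * E i := by
    intro i
    have hm := measurable_enorm_sub_sq (hF i)
    have hm1 : Measurable (fun x => ∫⁻ y, ‖F i x - F i y‖ₑ ^ 2 ∂ν) := hm.lintegral_prod_right'
    calc ν univ * ∫⁻ x, ∫⁻ z, ‖F i x - F i z‖ₑ ^ 2 ∂κ ∂μ
        = ∫⁻ x, ∫⁻ z, ∫⁻ _, ‖F i x - F i z‖ₑ ^ 2 ∂ν ∂κ ∂μ := by
          rw [← lintegral_const_mul' _ _ hνt]
          refine lintegral_congr fun x => ?_
          rw [← lintegral_const_mul' _ _ hνt]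
          refine lintegral_congr fun z => ?_
          rw [lintegral_const, mul_comm]
      _ ≤ ∫⁻ x, ∫⁻ z, 2 * ((∫⁻ y, ‖F i x - F i y‖ₑ ^ 2 ∂ν) + ∫⁻ y, ‖F i z - F i y‖ₑ ^ 2 ∂ν) ∂κ ∂μ := by
          refine lintegral_mono fun x => lintegral_mono fun z => ?_
          rw [← lintegral_add_left (by have := hF i; fun_prop),
            ← lintegral_const_mul' _ _ (by simp)]
          refine lintegral_mono fun y => ?_
          rw [enorm_sub_rev (F i z)]
          exact enorm_sub_sq_le _ _ _
      _ = 2 * (κ univ * (∫⁻ x, ∫⁻ y, ‖F i x - F i y‖ₑ ^ 2 ∂ν ∂μ)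
            + (∫⁻ z, ∫⁻ y, ‖F i z - F i y‖ₑ ^ 2 ∂ν ∂κ) * μ univ) := by
          simp_rw [lintegral_const_mul' 2 _ (by simp : (2 : ℝ≥0∞) ≠ ⊤)]
          congr 1
          simp_rw [lintegral_add_left measurable_const, lintegral_const]
          rw [lintegral_add_right _ measurable_const, lintegral_const, lintegral_mul_const _ hm1,
            mul_comm (κ univ)]
      _ ≤ 2 * (κ univ * (C * E i) + (C' * E i) * μ univ) := by
          gcongr
          exacts [hC i, hC' i]
      _ = _ := by ring
  refine ⟨((ν univ)⁻¹ * (2 * (κ univ * C + C' * μ univ))).toNNReal, fun i => ?_⟩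
  rw [ENNReal.coe_toNNReal]
  · rw [mul_assoc]
    calc _ = (ν univ)⁻¹ * (ν univ * ∫⁻ x, ∫⁻ z, ‖F i x - F i z‖ₑ ^ 2 ∂κ ∂μ) := by
          rw [← mul_assoc, ENNReal.inv_mul_cancel hν0 hνt, one_mul]
      _ ≤ _ := mul_le_mul' le_rfl (key i)
  · have : κ univ ≠ ⊤ := measure_ne_top _ _
    have : μ univ ≠ ⊤ := measure_ne_top _ _
    finiteness

end OscControlled

/-- Oscillation between product measures, along paths that move one variable at a time. -/
theorem lintegral_prod_oscillation_le {A B : Type*} [MeasurableSpace A] [MeasurableSpace B]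
    {f : A × B → ℝ} (hf : Measurable f) (μ ν : Measure A) (κ κ' : Measure B)
    [SFinite μ] [SFinite ν] [SFinite κ] [SFinite κ'] :
    ∫⁻ p, ∫⁻ q, ‖f p - f q‖ₑ ^ 2 ∂(ν.prod κ') ∂(μ.prod κ) ≤
      2 * (ν univ * (∫⁻ a, ∫⁻ b, ∫⁻ b', ‖f (a, b) - f (a, b')‖ₑ ^ 2 ∂κ' ∂κ ∂μ)
        + κ univ * (∫⁻ b', ∫⁻ a, ∫⁻ a', ‖f (a, b') - f (a', b')‖ₑ ^ 2 ∂ν ∂μ ∂κ')) := by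
  -- The path turns at `(p.1, b')`: first the second variable moves, then the first.
  have e1 : ∀ p, ∫⁻ q, ‖f p - f q‖ₑ ^ 2 ∂(ν.prod κ')
      ≤ 2 * (ν univ * (∫⁻ b', ‖f p - f (p.1, b')‖ₑ ^ 2 ∂κ')
        + ∫⁻ b', ∫⁻ a', ‖f (p.1, b') - f (a', b')‖ₑ ^ 2 ∂ν ∂κ') := by
    intro p
    rw [lintegral_prod_symm _ (by fun_prop), ← lintegral_const_mul _ (by fun_prop),
      ← lintegral_add_left (by fun_prop), ← lintegral_const_mul _ (by fun_prop)]
    refine lintegral_mono fun b' => ?_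
    calc _ ≤ ∫⁻ a', 2 * (‖f p - f (p.1, b')‖ₑ ^ 2 + ‖f (p.1, b') - f (a', b')‖ₑ ^ 2) ∂ν :=
          lintegral_mono fun a' => enorm_sub_sq_le _ _ _
      _ = _ := by
          rw [lintegral_const_mul _ (by fun_prop), lintegral_add_left measurable_const,
            lintegral_const, mul_comm (ν univ)]
  have m1 : Measurable fun p : A × B => ∫⁻ b', ‖f p - f (p.1, b')‖ₑ ^ 2 ∂κ' := by fun_prop
  have m2 : Measurable fun a : A => ∫⁻ b', ∫⁻ a', ‖f (a, b') - f (a', b')‖ₑ ^ 2 ∂ν ∂κ' := by fun_prop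
  calc _ ≤ _ := lintegral_mono e1
    _ = _ := by
      rw [lintegral_const_mul _ (by fun_prop), lintegral_add_left (by fun_prop),
        lintegral_const_mul _ m1, lintegral_prod _ m1.aemeasurable]
      congr 3
      rw [lintegral_prod _ (by fun_prop)]
      simp only [lintegral_const]
      rw [lintegral_mul_const _ m2, mul_comm]
      congr 1
      exact lintegral_lintegral_swap (by fun_prop)

end Oscillation

/-! ### Oscillation along segments and in graph charts -/

/-- The fundamental theorem of calculus with the Cauchy–Schwarz inequality. -/
theorem enorm_sub_sq_le_lintegral_deriv {f : ℝ → ℝ} (hf : ContDiff ℝ 1 f) {a b s t : ℝ}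
    (hs : s ∈ Icc a b) (ht : t ∈ Icc a b) :
    ‖f s - f t‖ₑ ^ 2 ≤ ENNReal.ofReal (b - a) * ∫⁻ θ in Ioo a b, ‖deriv f θ‖ₑ ^ 2 := by
  wlog hst : t ≤ s generalizing s t
  · rw [enorm_sub_rev]
    exact this ht hs (le_of_not_ge hst)
  have hd : Continuous (deriv f) := hf.continuous_deriv le_rfl
  have h1 : f s - f t = ∫ θ in t..s, deriv f θ := by
    rw [intervalIntegral.integral_deriv_eq_sub]
    · exact fun x _ => (hf.differentiable one_ne_zero).differentiableAt
    · exact hd.intervalIntegrable _ _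
  have h2 : ‖f s - f t‖ₑ ≤ ∫⁻ θ in Ioo a b, ‖deriv f θ‖ₑ := by
    rw [h1, intervalIntegral.integral_of_le hst, restrict_Ioo_eq_restrict_Ioc]
    refine (enorm_integral_le_lintegral_enorm _).trans (lintegral_mono_set ?_)
    exact Ioc_subset_Ioc ht.1 hs.2
  -- Cauchy–Schwarz against the constant `1`, which produces the factor `b - a`.
  have h3 := ENNReal.lintegral_mul_le_Lp_mul_Lq (volume.restrict (Ioo a b))
    Real.HolderConjugate.two_two (f := fun _ => 1) (g := fun θ => ‖deriv f θ‖ₑ)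
    aemeasurable_const (by fun_prop)
  simp only [Pi.mul_apply, one_mul, ENNReal.one_rpow, lintegral_const, Measure.restrict_apply_univ,
    Real.volume_Ioo] at h3
  calc ‖f s - f t‖ₑ ^ 2 ≤ _ := pow_le_pow_left' (h2.trans h3) 2
    _ = _ := by
      rw [mul_pow, ← ENNReal.rpow_natCast, ← ENNReal.rpow_natCast, ← ENNReal.rpow_mul,
        ← ENNReal.rpow_mul]
      norm_num

section Chart

variable (L : Plane ≃ₗᵢ[ℝ] Plane)

/-- The point with coordinates `p` in the orthonormal frame given by `L`. -/
noncomputable def chart (p : ℝ × ℝ) : Plane := L.symm !₂[p.1, p.2]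

theorem apply_chart_zero (p : ℝ × ℝ) : L (chart L p) 0 = p.1 := by simp [chart]

theorem apply_chart_one (p : ℝ × ℝ) : L (chart L p) 1 = p.2 := by simp [chart]

theorem chart_apply (y : Plane) : chart L (L y 0, L y 1) = y := by
  rw [chart, LinearIsometryEquiv.symm_apply_eq]
  ext i
  fin_cases i <;> simp

theorem chart_eq (p : ℝ × ℝ) :
    chart L p = p.1 • L.symm (EuclideanSpace.single 0 1) + p.2 • L.symm (EuclideanSpace.single 1 1) := by
  rw [← map_smul, ← map_smul, ← map_add, chart]
  congr 1
  ext i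
  fin_cases i <;> simp

theorem continuous_chart : Continuous (chart L) := by
  have : chart L = fun p => p.1 • L.symm (EuclideanSpace.single 0 1)
    + p.2 • L.symm (EuclideanSpace.single 1 1) := funext (chart_eq L)
  rw [this]
  fun_prop

theorem measurePreserving_chart : MeasurePreserving (chart L) volume volume := by
  have h1 := (volume_preserving_finTwoArrow ℝ).symm
  have h2 := PiLp.volume_preserving_toLp (Fin 2)
  have h3 := L.symm.measurePreserving
  exact h3.comp (h2.comp h1)

theorem enorm_deriv_comp_line_le {f : Plane → ℝ} (hf : ContDiff ℝ 1 f) (a e : Plane) (he : ‖e‖ = 1)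
    (t : ℝ) : ‖deriv (fun θ : ℝ => f (a + θ • e)) t‖ₑ ≤ ‖fderiv ℝ f (a + t • e)‖ₑ := by
  have h1 : HasDerivAt (fun θ : ℝ => a + θ • e) e t := by
    simpa using ((hasDerivAt_id t).smul_const e).const_add a
  have h2 : HasFDerivAt f (fderiv ℝ f (a + t • e)) (a + t • e) :=
    ((hf.differentiable one_ne_zero) _).hasFDerivAt
  have h3 := h2.comp_hasDerivAt t h1
  have h4 : deriv (fun θ : ℝ => f (a + θ • e)) t = fderiv ℝ f (a + t • e) e := h3.deriv
  rw [h4, enorm_le_iff_norm_le]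
  simpa [he] using (fderiv ℝ f (a + t • e)).le_opNorm e

theorem contDiff_comp_line {f : Plane → ℝ} (hf : ContDiff ℝ 1 f) (a e : Plane) :
    ContDiff ℝ 1 (fun θ : ℝ => f (a + θ • e)) := by fun_prop

end Chart

/-- Continuously differentiable functions on the plane. -/
abbrev PlaneFun : Type := {f : Plane → ℝ // ContDiff ℝ 1 f}

/-- The Dirichlet energy on `Ω`. -/
noncomputable def dirichletEnergy (Ω : Set Plane) (f : PlaneFun) : ℝ≥0∞ :=
  ∫⁻ x in Ω, ‖fderiv ℝ f.1 x‖ₑ ^ 2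

/-- The oscillation of functions on `Ω` is controlled by the Dirichlet energy. -/
abbrev DirichletControlled (Ω : Set Plane) (μ ν : Measure Plane) : Prop :=
  OscControlled (fun f : PlaneFun => f.1) (dirichletEnergy Ω) μ ν

theorem PlaneFun.measurable (f : PlaneFun) : Measurable f.1 := f.2.continuous.measurable

/-- A measure living on the vertical segments over a graph is controlled with respect to the
rectangle at the top of these segments. -/
theorem dirichletControlled_chart {Ω : Set Plane} (hΩ : MeasurableSet Ω) (L : Plane ≃ₗᵢ[ℝ] Plane)
    {s₁ s₂ t₁ t₂ H : ℝ} {γ : ℝ → ℝ} (hγ : ∀ s ∈ Ioo s₁ s₂, γ s ≤ t₁)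
    (hH : ∀ s ∈ Ioo s₁ s₂, t₂ - γ s ≤ H)
    (hsub : ∀ s ∈ Ioo s₁ s₂, ∀ t ∈ Ioo (γ s) t₂, chart L (s, t) ∈ Ω)
    (μ : Measure (ℝ × ℝ)) [IsFiniteMeasure μ]
    (hμ : ∀ᵐ p ∂μ, p.1 ∈ Ioo s₁ s₂ ∧ p.2 ∈ Icc (γ p.1) t₂) (C : ℝ≥0)
    (hfst : μ.map Prod.fst ≤ C • volume.restrict (Ioo s₁ s₂)) :
    DirichletControlled Ω (μ.map (chart L))
      ((volume.restrict (Ioo s₁ s₂ ×ˢ Ioo t₁ t₂)).map (chart L)) := by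
  have hΦ : Measurable (chart L) := (continuous_chart L).measurable
  set w := ENNReal.ofReal (s₂ - s₁) with hw
  refine ⟨(2 * (ENNReal.ofReal H * (w * ENNReal.ofReal (t₂ - t₁)) * C + w * w * μ univ)).toNNReal,
    fun f => ?_⟩
  rw [ENNReal.coe_toNNReal (by finiteness)]
  obtain ⟨f, hf⟩ := f
  have hfm : Measurable f := hf.continuous.measurable
  set e0 : Plane := L.symm (EuclideanSpace.single 0 1) with he0
  set e1 : Plane := L.symm (EuclideanSpace.single 1 1) with he1
  have n0 : ‖e0‖ = 1 := by simp [e0]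
  have n1 : ‖e1‖ = 1 := by simp [e1]
  -- Extending the energy density by zero allows integrals over full lines, and Tonelli then
  -- recovers the energy exactly in either order (`iv`, `ih`).
  set g : Plane → ℝ≥0∞ := Ω.indicator fun x => ‖fderiv ℝ f x‖ₑ ^ 2 with hg
  have hdf : Measurable (fderiv ℝ f) := (hf.continuous_fderiv one_ne_zero).measurable
  have hgm : Measurable g := (hdf.enorm.pow_const 2).indicator hΩ
  set ev : ℝ → ℝ≥0∞ := fun s => ∫⁻ θ, g (chart L (s, θ)) with hev
  set eh : ℝ → ℝ≥0∞ := fun t => ∫⁻ θ, g (chart L (θ, t)) with heh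
  have mv : Measurable ev := by fun_prop
  have mh : Measurable eh := by fun_prop
  have hE : ∫⁻ p, g (chart L p) = dirichletEnergy Ω ⟨f, hf⟩ := by
    rw [(measurePreserving_chart L).lintegral_comp hgm, dirichletEnergy, hg,
      lintegral_indicator hΩ]
  have iv : ∫⁻ s, ev s = dirichletEnergy Ω ⟨f, hf⟩ := by
    rw [← hE, Measure.volume_eq_prod, lintegral_prod _ (by fun_prop)]
  have ih : ∫⁻ t, eh t = dirichletEnergy Ω ⟨f, hf⟩ := by
    rw [← hE, Measure.volume_eq_prod, lintegral_prod_symm _ (by fun_prop)]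
  have cv : ∀ s t : ℝ, chart L (s, t) = s • e0 + t • e1 := fun s t => chart_eq L _
  have ch : ∀ s t : ℝ, chart L (s, t) = t • e1 + s • e0 := fun s t => by rw [cv, add_comm]
  have V : ∀ p : ℝ × ℝ, (p.1 ∈ Ioo s₁ s₂ ∧ p.2 ∈ Icc (γ p.1) t₂) → ∀ t ∈ Ioo t₁ t₂,
      ‖f (chart L p) - f (chart L (p.1, t))‖ₑ ^ 2 ≤ ENNReal.ofReal H * ev p.1 := by
    rintro ⟨s, t'⟩ ⟨hs, ht'⟩ t ht
    rw [cv, cv]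
    refine (enorm_sub_sq_le_lintegral_deriv (contDiff_comp_line hf (s • e0) e1) ht'
      ⟨(hγ s hs).trans ht.1.le, ht.2.le⟩).trans ?_
    gcongr
    · exact hH s hs
    · refine le_trans ?_ (setLIntegral_le_lintegral (Ioo (γ s) t₂) _)
      refine setLIntegral_mono (by fun_prop) fun θ hθ => ?_
      have : chart L (s, θ) ∈ Ω := hsub s hs θ hθ
      rw [hg, indicator_of_mem this, cv]
      gcongr
      exact enorm_deriv_comp_line_le hf _ _ n1 _
  -- Horizontal moves are made only at heights above `t₁`, where the whole segment lies over the
  -- graph and hence in `Ω`.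
  have Hz : ∀ t ∈ Ioo t₁ t₂, ∀ s ∈ Ioo s₁ s₂, ∀ s' ∈ Ioo s₁ s₂,
      ‖f (chart L (s, t)) - f (chart L (s', t))‖ₑ ^ 2 ≤ w * eh t := by
    intro t ht s hs s' hs'
    rw [ch, ch]
    refine (enorm_sub_sq_le_lintegral_deriv (contDiff_comp_line hf (t • e1) e0)
      (Ioo_subset_Icc_self hs) (Ioo_subset_Icc_self hs')).trans ?_
    gcongr
    refine le_trans ?_ (setLIntegral_le_lintegral (Ioo s₁ s₂) _)
    refine setLIntegral_mono (by fun_prop) fun θ hθ => ?_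
    have : chart L (θ, t) ∈ Ω := hsub θ hθ t ⟨(hγ θ hθ).trans_lt ht.1, ht.2⟩
    rw [hg, indicator_of_mem this, ch]
    gcongr
    exact enorm_deriv_comp_line_le hf _ _ n0 _
  have inner_le : ∀ p : ℝ × ℝ, (p.1 ∈ Ioo s₁ s₂ ∧ p.2 ∈ Icc (γ p.1) t₂) →
      ∫⁻ q in Ioo s₁ s₂ ×ˢ Ioo t₁ t₂, ‖f (chart L p) - f (chart L q)‖ₑ ^ 2 ≤
        2 * (ENNReal.ofReal H * (w * ENNReal.ofReal (t₂ - t₁)) * ev p.1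
          + w * w * dirichletEnergy Ω ⟨f, hf⟩) := by
    intro p hp
    calc _ ≤ ∫⁻ q in Ioo s₁ s₂ ×ˢ Ioo t₁ t₂, 2 * (ENNReal.ofReal H * ev p.1 + w * eh q.2) := by
          refine setLIntegral_mono (by fun_prop) fun q hq => ?_
          refine (enorm_sub_sq_le _ (f (chart L (p.1, q.2))) _).trans ?_
          gcongr
          · exact V p hp _ hq.2
          · exact Hz _ hq.2 _ hp.1 _ hq.1
      _ = 2 * (ENNReal.ofReal H * ev p.1 * (w * ENNReal.ofReal (t₂ - t₁))
          + w * (w * ∫⁻ t in Ioo t₁ t₂, eh t)) := by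
          rw [lintegral_const_mul _ (by fun_prop), lintegral_add_left measurable_const,
            lintegral_const, lintegral_const_mul _ (by fun_prop), Measure.volume_eq_prod,
            ← Measure.prod_restrict, lintegral_prod _ (by fun_prop)]
          simp only [lintegral_const, Measure.restrict_apply_univ, Real.volume_Ioo]
          rw [← univ_prod_univ, Measure.prod_prod]
          simp only [Measure.restrict_apply_univ, Real.volume_Ioo, ← hw]
          rw [mul_comm (lintegral _ _) w]
      _ ≤ 2 * (ENNReal.ofReal H * ev p.1 * (w * ENNReal.ofReal (t₂ - t₁)) + w * (w * ∫⁻ t, eh t)) := by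
          gcongr
          exact Measure.restrict_le_self
      _ = _ := by rw [ih]; ring
  have hconv : ∀ x, ∫⁻ y, ‖f x - f y‖ₑ ^ 2
      ∂((volume.restrict (Ioo s₁ s₂ ×ˢ Ioo t₁ t₂)).map (chart L))
      = ∫⁻ q in Ioo s₁ s₂ ×ˢ Ioo t₁ t₂, ‖f x - f (chart L q)‖ₑ ^ 2 :=
    fun x => lintegral_map (by fun_prop) hΦ
  simp only [hconv]
  rw [lintegral_map (by fun_prop) hΦ]
  calc _ ≤ _ := lintegral_mono_ae (hμ.mono inner_le)
    _ = 2 * (ENNReal.ofReal H * (w * ENNReal.ofReal (t₂ - t₁)) * (∫⁻ s, ev s ∂(μ.map Prod.fst))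
          + w * w * dirichletEnergy Ω ⟨f, hf⟩ * μ univ) := by
        rw [lintegral_const_mul _ (by fun_prop), lintegral_add_right _ measurable_const,
          lintegral_const, lintegral_const_mul _ (by fun_prop), lintegral_map mv measurable_fst]
    _ ≤ 2 * (ENNReal.ofReal H * (w * ENNReal.ofReal (t₂ - t₁)) * (C * dirichletEnergy Ω ⟨f, hf⟩)
          + w * w * dirichletEnergy Ω ⟨f, hf⟩ * μ univ) := by
        gcongr
        -- The vertical energy `ev` depends on the first coordinate alone, so only the projection of
        -- `μ` needs a bounded density. This admits measures singular to area, such as length on the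
        -- graph.
        refine (lintegral_mono' hfst le_rfl).trans ?_
        rw [lintegral_smul_measure, ← iv]
        change (C : ℝ≥0∞) * _ ≤ _
        gcongr
        exact Measure.restrict_le_self
    _ = _ := by ring

section Box

variable (L : Plane ≃ₗᵢ[ℝ] Plane)

/-- The set of points whose coordinates in the frame `L` lie in `A`. -/
def box (A : Set (ℝ × ℝ)) : Set Plane := {y | (L y 0, L y 1) ∈ A}

theorem preimage_chart_box (A : Set (ℝ × ℝ)) : chart L ⁻¹' box L A = A := by
  ext p
  simp [box, apply_chart_zero, apply_chart_one]

theorem continuous_coord : Continuous fun y : Plane => (L y 0, L y 1) := by fun_prop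

theorem isOpen_box {A : Set (ℝ × ℝ)} (hA : IsOpen A) : IsOpen (box L A) :=
  hA.preimage (continuous_coord L)

theorem measurableSet_box {A : Set (ℝ × ℝ)} (hA : MeasurableSet A) : MeasurableSet (box L A) :=
  (continuous_coord L).measurable hA

theorem map_chart_restrict {A : Set (ℝ × ℝ)} (hA : MeasurableSet A) :
    (volume.restrict A).map (chart L) = volume.restrict (box L A) := by
  have := ((measurePreserving_chart L).restrict_preimage (measurableSet_box L hA)).map_eq
  rwa [preimage_chart_box] at this

theorem dist_chart_le (p q : ℝ × ℝ) :
    dist (chart L p) (chart L q) ≤ |p.1 - q.1| + |p.2 - q.2| := by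
  rw [dist_eq_norm, chart_eq, chart_eq]
  calc _ = ‖(p.1 - q.1) • L.symm (EuclideanSpace.single 0 1)
        + (p.2 - q.2) • L.symm (EuclideanSpace.single 1 1)‖ := by
        congr 1; module
    _ ≤ _ := (norm_add_le _ _).trans (by simp [norm_smul])

theorem dist_chart_self_le (p : ℝ × ℝ) (x : Plane) :
    dist (chart L p) x ≤ |p.1 - L x 0| + |p.2 - L x 1| := by
  simpa [chart_apply] using dist_chart_le L p (L x 0, L x 1)

end Box

/-! ### The Poincaré–Wirtinger inequality on a Lipschitz domain -/

/-- The area measure on `Ω` together with the length measure on its boundary. -/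
noncomputable def closureMeasure (Ω : Set Plane) : Measure Plane :=
  volume.restrict Ω + (Measure.hausdorffMeasure 1).restrict (frontier Ω)

/-- A small square inside `Ω` is the region over a constant graph, so `dirichletControlled_chart`
applies with the square in both roles. -/
theorem exists_nhds_dirichletControlled_of_mem {Ω : Set Plane} (hΩ : IsOpen Ω) {x : Plane}
    (hx : x ∈ Ω) :
    ∃ U ∈ 𝓝 x, U ⊆ Ω ∧ DirichletControlled Ω (volume.restrict U) (volume.restrict U) := by
  obtain ⟨ρ, hρ, hball⟩ := Metric.isOpen_iff.1 hΩ x hx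
  let L : Plane ≃ₗᵢ[ℝ] Plane := LinearIsometryEquiv.refl ℝ Plane
  let r := ρ / 2
  have hr : 0 < r := by positivity
  let S := Ioo (L x 0 - r) (L x 0 + r)
  let J := Ioo (L x 1 - r) (L x 1 + r)
  have hsub : ∀ p ∈ S ×ˢ J, chart L p ∈ Ω := by
    rintro p ⟨h1, h2⟩
    apply hball
    have a1 : |p.1 - L x 0| < r := by rw [abs_lt]; constructor <;> linarith [h1.1, h1.2]
    have a2 : |p.2 - L x 1| < r := by rw [abs_lt]; constructor <;> linarith [h2.1, h2.2]
    have := dist_chart_self_le L p x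
    rw [Metric.mem_ball]
    have : r = ρ / 2 := rfl
    linarith
  have hU : IsOpen (S ×ˢ J) := isOpen_Ioo.prod isOpen_Ioo
  refine ⟨box L (S ×ˢ J), (isOpen_box L hU).mem_nhds ?_, ?_, ?_⟩
  · exact ⟨⟨by simp [hr], by simp [hr]⟩, ⟨by simp [hr], by simp [hr]⟩⟩
  · intro y hy
    have := hsub _ hy
    rwa [chart_apply] at this
  · rw [← map_chart_restrict L hU.measurableSet]
    have hfin : IsFiniteMeasure (volume.restrict (S ×ˢ J)) := by
      rw [Measure.volume_eq_prod, ← Measure.prod_restrict]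
      infer_instance
    refine dirichletControlled_chart hΩ.measurableSet L (γ := fun _ => L x 1 - r) (H := 2 * r)
      (fun _ _ => le_rfl) (fun _ _ => by linarith) (fun s hs t ht => hsub (s, t) ⟨hs, ht⟩) _ ?_
      (2 * r).toNNReal ?_
    · filter_upwards [ae_restrict_mem hU.measurableSet] with p hp
      exact ⟨hp.1, Ioo_subset_Icc_self hp.2⟩
    · rw [Measure.volume_eq_prod, ← Measure.prod_restrict, Measure.map_fst_prod,
        Measure.restrict_apply_univ, Real.volume_Ioo, show L x 1 + r - (L x 1 - r) = 2 * r by ring]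
      exact le_rfl

/-- A point strictly above the graph would belong to `Ω`, and one strictly below would have a
neighbourhood missing `Ω`; a frontier point of an open set does neither. -/
theorem eq_of_mem_frontier_of_eventually {Ω : Set Plane} (hΩ : IsOpen Ω) {L : Plane ≃ₗᵢ[ℝ] Plane}
    {γ : ℝ → ℝ} (hγ : Continuous γ) {y : Plane} (hy : y ∈ frontier Ω)
    (h : ∀ᶠ w in 𝓝 y, (w ∈ Ω ↔ γ (L w 0) < L w 1)) : L y 1 = γ (L y 0) := by
  rw [hΩ.frontier_eq] at hy
  apply le_antisymm
  · by_contra! hlt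
    exact hy.2 (h.self_of_nhds.2 hlt)
  · by_contra! hlt
    have h1 : ∀ᶠ w in 𝓝 y, L w 1 < γ (L w 0) :=
      ContinuousAt.eventually_lt (by fun_prop) (by fun_prop) hlt
    obtain ⟨w, hw, hw1, hw2⟩ :=
      ((mem_closure_iff_frequently.1 hy.1).and_eventually (h.and h1)).exists
    exact absurd (hw1.1 hw) (not_lt.2 hw2.le)

/-- Area above a Lipschitz graph and length on it both project to the base interval with bounded
density, so both are controlled by a rectangle `R` lying above the graph inside `Ω`. -/
theorem exists_nhds_dirichletControlled_of_mem_frontier {Ω : Set Plane} (hΩ : IsLipschitzDomain Ω)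
    {x : Plane} (hx : x ∈ frontier Ω) :
    ∃ U ∈ 𝓝 x, closureMeasure Ω U < ⊤ ∧ ∃ R ⊆ Ω, IsOpen R ∧ R.Nonempty ∧ volume R < ⊤ ∧
      DirichletControlled Ω ((closureMeasure Ω).restrict U) (volume.restrict R) := by
  obtain ⟨L, γ, K, hγ, hev⟩ := hΩ.lipschitz_boundary x hx
  obtain ⟨ρ, hρ, hball⟩ := Metric.eventually_nhds_iff_ball.1 hev
  have ht0 : L x 1 = γ (L x 0) := eq_of_mem_frontier_of_eventually hΩ.isOpen hγ.continuous hx hev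
  -- Room for the box and the rectangle above it: points with `|s - s0| < r ≤ η` and `|t - t0| < 2η`
  -- stay within `3η < ρ` of `x`. The condition `K * r ≤ η` below keeps the graph within `η` of
  -- `t0`; dividing by `K + 1` also covers `K = 0`.
  obtain ⟨η, hη, hηρ⟩ : ∃ η : ℝ, 0 < η ∧ 8 * η = ρ := ⟨ρ / 8, by positivity, by ring⟩
  obtain ⟨r, hr, hrη, hKr⟩ : ∃ r : ℝ, 0 < r ∧ r ≤ η ∧ K * r ≤ η := by
    refine ⟨η / (K + 1), by positivity, div_le_self hη.le (by simp), ?_⟩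
    rw [mul_div_assoc', div_le_iff₀ (by positivity)]
    nlinarith [K.coe_nonneg]
  set s0 := L x 0 with hs0
  set t0 := L x 1 with ht0'
  set S := Ioo (s0 - r) (s0 + r) with hS
  set J := Ioo (t0 - η) (t0 + η) with hJ
  have hSabs : ∀ s ∈ S, |s - s0| < r := fun s hs => by
    rw [abs_lt]; constructor <;> linarith [hs.1, hs.2]
  have hγS : ∀ s ∈ S, |γ s - t0| < η := by
    intro s hs
    have h1 := hγ.dist_le_mul s s0
    rw [Real.dist_eq, Real.dist_eq, ← ht0] at h1
    rcases eq_or_lt_of_le K.coe_nonneg with hK | hK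
    · rw [← hK, zero_mul] at h1; linarith
    · have := mul_lt_mul_of_pos_left (hSabs s hs) hK
      linarith
  have hγl : ∀ s ∈ S, t0 - η < γ s := fun s hs => by linarith [(abs_lt.1 (hγS s hs)).1]
  have hγu : ∀ s ∈ S, γ s < t0 + η := fun s hs => by linarith [(abs_lt.1 (hγS s hs)).2]
  have hin : ∀ s ∈ S, ∀ t, |t - t0| < 2 * η → chart L (s, t) ∈ Metric.ball x ρ := by
    intro s hs t ht
    have h1 := dist_chart_self_le L (s, t) x
    have h2 := hSabs s hs
    rw [Metric.mem_ball]
    simp only [← hs0, ← ht0'] at h1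
    linarith
  have hsub : ∀ s ∈ S, ∀ t ∈ Ioo (γ s) (t0 + 2 * η), chart L (s, t) ∈ Ω := by
    intro s hs t ht
    refine (hball _ (hin s hs t ?_)).2 ?_
    · rw [abs_lt]; constructor <;> linarith [ht.1, ht.2, hγl s hs]
    · rw [apply_chart_zero, apply_chart_one]; exact ht.1
  set A : Set (ℝ × ℝ) := (S ×ˢ J) ∩ {p | γ p.1 < p.2} with hA
  have hAo : IsOpen A := (isOpen_Ioo.prod isOpen_Ioo).inter
    (isOpen_lt (hγ.continuous.comp continuous_fst) continuous_snd)
  set U := box L (S ×ˢ J) with hU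
  have hUo : IsOpen U := isOpen_box L (isOpen_Ioo.prod isOpen_Ioo)
  have hUball : U ⊆ Metric.ball x ρ := by
    intro y hy
    have := hin _ hy.1 (L y 1) (by
      have h1 := hy.2.1
      have h2 := hy.2.2
      rw [abs_lt]; constructor <;> linarith)
    rwa [chart_apply] at this
  have hUΩ : U ∩ Ω ⊆ box L A := fun y hy => ⟨hy.1, (hball y (hUball hy.1)).1 hy.2⟩
  set G : ℝ → Plane := fun s => chart L (s, γ s) with hG
  have hUfr : U ∩ frontier Ω ⊆ G '' S := by
    intro y hy
    have h1 : L y 1 = γ (L y 0) := eq_of_mem_frontier_of_eventually hΩ.isOpen hγ.continuous hy.2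
      (by filter_upwards [Metric.isOpen_ball.mem_nhds (hUball hy.1)] with w hw using hball w hw)
    exact ⟨L y 0, hy.1.1, by rw [hG]; simp only; rw [← h1, chart_apply]⟩
  have hGlip : LipschitzWith (1 + K) G := by
    refine LipschitzWith.of_dist_le_mul fun s s' => (dist_chart_le L _ _).trans ?_
    have := hγ.dist_le_mul s s'
    rw [Real.dist_eq, Real.dist_eq] at this
    rw [Real.dist_eq]
    push_cast
    linarith
  have hgm : Measurable fun s : ℝ => (s, γ s) := by
    have := hγ.continuous
    fun_prop
  have hΦ : Measurable (chart L) := (continuous_chart L).measurable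
  -- In coordinates this dominates area plus boundary length near `x`: the graph parametrization is
  -- `(1 + K)`-Lipschitz, so it stretches length by at most that factor.
  set μ : Measure (ℝ × ℝ) := volume.restrict A
    + (1 + K) • (volume.restrict S).map (fun s => (s, γ s)) with hμ
  have hfinSJ : IsFiniteMeasure (volume.restrict (S ×ˢ J)) := by
    rw [Measure.volume_eq_prod, ← Measure.prod_restrict]
    infer_instance
  have hAle : volume.restrict A ≤ volume.restrict (S ×ˢ J) :=
    Measure.restrict_mono inter_subset_left le_rfl
  have hfinA : IsFiniteMeasure (volume.restrict A) := isFiniteMeasure_of_le _ hAle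
  have hfinμ : IsFiniteMeasure μ := by infer_instance
  have hle : (closureMeasure Ω).restrict U ≤ μ.map (chart L) := by
    rw [closureMeasure, Measure.restrict_add, hμ, Measure.map_add _ _ hΦ, Measure.map_smul,
      Measure.map_map hΦ hgm, map_chart_restrict L hAo.measurableSet,
      Measure.restrict_restrict hUo.measurableSet, Measure.restrict_restrict hUo.measurableSet]
    refine add_le_add (Measure.restrict_mono hUΩ le_rfl) ?_
    refine Measure.le_iff.2 fun B hB => ?_
    rw [Measure.restrict_apply hB, Measure.smul_apply, Measure.map_apply (hΦ.comp hgm) hB,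
      Measure.restrict_apply ((hΦ.comp hgm) hB)]
    calc _ ≤ Measure.hausdorffMeasure 1 (G '' (G ⁻¹' B ∩ S)) := by
          apply measure_mono
          rintro y ⟨hyB, hy⟩
          obtain ⟨s, hs, rfl⟩ := hUfr hy
          exact ⟨s, ⟨hyB, hs⟩, rfl⟩
      _ ≤ _ := (hGlip.lipschitzOnWith (s := G ⁻¹' B ∩ S)).hausdorffMeasure_image_le zero_le_one
      _ = _ := by
          rw [hausdorffMeasure_real, ENNReal.rpow_one]
          rfl
  have hctl : DirichletControlled Ω (μ.map (chart L))
      ((volume.restrict (S ×ˢ Ioo (t0 + η) (t0 + 2 * η))).map (chart L)) := by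
    refine dirichletControlled_chart hΩ.isOpen.measurableSet L (γ := γ) (H := 3 * η)
      (fun s hs => (hγu s hs).le) (fun s hs => by linarith [hγl s hs]) hsub μ ?_
      -- The projection of the area part has density at most the height `2η` of the box, that of the
      -- graph part `1 + K`.
      ((2 * η).toNNReal + (1 + K)) ?_
    · rw [hμ, ae_add_measure_iff]
      constructor
      · filter_upwards [ae_restrict_mem hAo.measurableSet] with p hp
        exact ⟨hp.1.1, le_of_lt hp.2, by linarith [hp.1.2.2]⟩
      · refine Measure.ae_smul_measure ?_ _
        rw [ae_map_iff hgm.aemeasurable]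
        · filter_upwards [ae_restrict_mem measurableSet_Ioo] with s hs
          exact ⟨hs, le_rfl, by linarith [hγu s hs]⟩
        · have := hγ.continuous
          have h1 : MeasurableSet {p : ℝ × ℝ | p.1 ∈ S} := measurable_fst measurableSet_Ioo
          have h2 : MeasurableSet {p : ℝ × ℝ | γ p.1 ≤ p.2} :=
            measurableSet_le (by fun_prop) (by fun_prop)
          have h3 : MeasurableSet {p : ℝ × ℝ | p.2 ≤ t0 + 2 * η} :=
            measurableSet_le (by fun_prop) (by fun_prop)
          exact h1.inter (h2.inter h3)
    · rw [hμ, Measure.map_add _ _ measurable_fst, Measure.map_smul,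
        Measure.map_map measurable_fst hgm, add_smul (2 * η).toNNReal]
      refine add_le_add ?_ ?_
      · refine (Measure.map_mono hAle measurable_fst).trans ?_
        rw [Measure.volume_eq_prod, ← Measure.prod_restrict, Measure.map_fst_prod,
          Measure.restrict_apply_univ, Real.volume_Ioo,
          show t0 + η - (t0 - η) = 2 * η by ring]
        exact le_rfl
      · have : Prod.fst ∘ (fun s : ℝ => (s, γ s)) = id := rfl
        rw [this, Measure.map_id]
  have hRo : IsOpen (S ×ˢ Ioo (t0 + η) (t0 + 2 * η)) := isOpen_Ioo.prod isOpen_Ioo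
  rw [map_chart_restrict L hRo.measurableSet] at hctl
  refine ⟨U, hUo.mem_nhds ⟨⟨by linarith, by linarith⟩, ⟨by linarith, by linarith⟩⟩, ?_,
    box L (S ×ˢ Ioo (t0 + η) (t0 + 2 * η)), ?_, isOpen_box L hRo, ?_, ?_, hctl.mono hle le_rfl⟩
  · rw [← Measure.restrict_apply_univ]
    exact (hle _).trans_lt (measure_lt_top _ _)
  · intro y hy
    have h1 : L y 1 ∈ Ioo (t0 + η) (t0 + 2 * η) := hy.2
    have := hsub _ hy.1 (L y 1) ⟨(hγu _ hy.1).trans h1.1, h1.2⟩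
    rwa [chart_apply] at this
  · refine ⟨chart L (s0, t0 + 3 / 2 * η), ?_⟩
    rw [← mem_preimage, preimage_chart_box]
    exact ⟨⟨by simp [hr], by simp [hr]⟩, by simp; linarith, by simp; linarith⟩
  · rw [← Measure.restrict_apply_univ, ← map_chart_restrict L hRo.measurableSet,
      Measure.volume_eq_prod, ← Measure.prod_restrict]
    exact measure_lt_top _ _

theorem IsLipschitzDomain.volume_lt_top {Ω : Set Plane} (hΩ : IsLipschitzDomain Ω) :
    volume Ω < ⊤ := hΩ.isBounded.measure_lt_top

/-- All small balls in a domain are controlled with respect to a fixed one. -/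
theorem IsLipschitzDomain.exists_base {Ω : Set Plane} (hΩ : IsLipschitzDomain Ω) :
    ∃ B ⊆ Ω, volume B ≠ 0 ∧
      ∀ y ∈ Ω, ∃ V ∈ 𝓝 y, V ⊆ Ω ∧ DirichletControlled Ω (volume.restrict V) (volume.restrict B) := by
  have fin : ∀ V ⊆ Ω, IsFiniteMeasure (volume.restrict V) := fun V hV =>
    ⟨by rw [Measure.restrict_apply_univ]; exact (measure_mono hV).trans_lt hΩ.volume_lt_top⟩
  have ne0 : ∀ {y : Plane} {V : Set Plane}, V ∈ 𝓝 y → volume.restrict V ≠ 0 := by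
    intro y V hV h
    exact (Measure.measure_pos_of_mem_nhds volume hV).ne' (Measure.restrict_eq_zero.1 h)
  obtain ⟨x₀, hx₀⟩ := hΩ.isConnected.nonempty
  let P : Plane → Plane → Prop := fun x y => ∃ U ∈ 𝓝 x, ∃ V ∈ 𝓝 y, U ⊆ Ω ∧ V ⊆ Ω ∧
    DirichletControlled Ω (volume.restrict U) (volume.restrict V)
  have hP : ∀ {x y}, x ∈ Ω → y ∈ Ω → P x y := by
    -- The relation `P` holds between nearby points, is transitive because two neighbourhoods of one
    -- point meet in positive area, and is symmetric; connectedness extends it to all pairs.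
    refine hΩ.isConnected.isPreconnected.induction₂ P ?_ ?_ ?_
    · intro x hx
      obtain ⟨U, hU, hUΩ, hctl⟩ := exists_nhds_dirichletControlled_of_mem hΩ.isOpen hx
      refine mem_nhdsWithin_of_mem_nhds ?_
      filter_upwards [eventually_mem_nhds_iff.2 hU] with y hy
      exact ⟨U, hU, U, hy, hUΩ, hUΩ, hctl⟩
    · rintro x y z - - - ⟨U, hU, V, hV, hUΩ, hVΩ, h1⟩ ⟨V', hV', W, hW, hVΩ', hWΩ, h2⟩
      have := fin U hUΩ
      have := fin W hWΩ
      have := fin (V ∩ V') (inter_subset_left.trans hVΩ)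
      refine ⟨U, hU, W, hW, hUΩ, hWΩ, ?_⟩
      exact (h1.mono le_rfl (Measure.restrict_mono inter_subset_left le_rfl)).trans
        PlaneFun.measurable (ne0 (inter_mem hV hV'))
        (h2.mono (Measure.restrict_mono inter_subset_right le_rfl) le_rfl)
    · rintro x y - - ⟨U, hU, V, hV, hUΩ, hVΩ, h⟩
      have := fin U hUΩ
      have := fin V hVΩ
      exact ⟨V, hV, U, hU, hVΩ, hUΩ, h.symm PlaneFun.measurable⟩
  obtain ⟨B, hB, hBΩ, hctl⟩ := exists_nhds_dirichletControlled_of_mem hΩ.isOpen hx₀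
  refine ⟨B, hBΩ, (Measure.measure_pos_of_mem_nhds volume hB).ne', fun y hy => ?_⟩
  obtain ⟨V, hV, W, hW, hVΩ, hWΩ, h⟩ := hP hy hx₀
  have := fin V hVΩ
  have := fin B hBΩ
  have := fin (W ∩ B) (inter_subset_left.trans hWΩ)
  refine ⟨V, hV, hVΩ, ?_⟩
  exact (h.mono le_rfl (Measure.restrict_mono inter_subset_left le_rfl)).trans
    PlaneFun.measurable (ne0 (inter_mem hW hB))
    (hctl.mono (Measure.restrict_mono inter_subset_right le_rfl) le_rfl)

theorem closureMeasure_restrict_closure (Ω : Set Plane) :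
    (closureMeasure Ω).restrict (closure Ω) = closureMeasure Ω := by
  rw [closureMeasure, Measure.restrict_add, Measure.restrict_restrict isClosed_closure.measurableSet,
    Measure.restrict_restrict isClosed_closure.measurableSet,
    inter_eq_self_of_subset_right subset_closure,
    inter_eq_self_of_subset_right frontier_subset_closure]

/-- The Poincaré–Wirtinger inequality with boundary values on a Lipschitz domain. -/
theorem IsLipschitzDomain.poincare {Ω : Set Plane} (hΩ : IsLipschitzDomain Ω) :
    IsFiniteMeasure (closureMeasure Ω) ∧
      DirichletControlled Ω (closureMeasure Ω) (closureMeasure Ω) := by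
  obtain ⟨B, hBΩ, hB0, hB⟩ := hΩ.exists_base
  have finB : IsFiniteMeasure (volume.restrict B) :=
    ⟨by rw [Measure.restrict_apply_univ]; exact (measure_mono hBΩ).trans_lt hΩ.volume_lt_top⟩
  have key : closureMeasure Ω (closure Ω) < ⊤ ∧
      DirichletControlled Ω ((closureMeasure Ω).restrict (closure Ω)) (volume.restrict B) := by
    -- Finiteness and control are inherited by subsets and finite unions, so by compactness a
    -- neighbourhood of each point of the closure suffices.
    refine hΩ.isBounded.isCompact_closure.induction_on
      (p := fun s => closureMeasure Ω s < ⊤ ∧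
        DirichletControlled Ω ((closureMeasure Ω).restrict s) (volume.restrict B)) ?_ ?_ ?_ ?_
    · simpa using OscControlled.zero_left
    · exact fun s t hst h => ⟨(measure_mono hst).trans_lt h.1,
        h.2.mono (Measure.restrict_mono hst le_rfl) le_rfl⟩
    · exact fun s t hs ht => ⟨measure_union_lt_top hs.1 ht.1,
        (hs.2.add_left ht.2).mono (Measure.restrict_union_le s t) le_rfl⟩
    · intro x hx
      by_cases hxΩ : x ∈ Ω
      · obtain ⟨V, hV, hVΩ, h⟩ := hB x hxΩ
        have hle : (closureMeasure Ω).restrict (interior V) ≤ volume.restrict V := by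
          rw [closureMeasure, Measure.restrict_add,
            Measure.restrict_restrict isOpen_interior.measurableSet,
            Measure.restrict_restrict isOpen_interior.measurableSet]
          have : interior V ∩ frontier Ω = ∅ := by
            rw [hΩ.isOpen.frontier_eq]
            exact eq_empty_of_forall_notMem fun y hy => hy.2.2 (hVΩ (interior_subset hy.1))
          rw [this, Measure.restrict_empty, add_zero]
          exact Measure.restrict_mono (inter_subset_left.trans interior_subset) le_rfl
        refine ⟨interior V, mem_nhdsWithin_of_mem_nhds (interior_mem_nhds.2 hV), ?_,
          h.mono hle le_rfl⟩
        rw [← Measure.restrict_apply_univ]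
        refine (hle _).trans_lt ?_
        rw [Measure.restrict_apply_univ]
        exact (measure_mono hVΩ).trans_lt hΩ.volume_lt_top
      · have hfr : x ∈ frontier Ω := by
          rw [hΩ.isOpen.frontier_eq]
          exact ⟨hx, hxΩ⟩
        obtain ⟨U, hU, hUfin, R, hRΩ, hRo, ⟨y, hy⟩, hRfin, h⟩ :=
          exists_nhds_dirichletControlled_of_mem_frontier hΩ hfr
        -- The boundary neighbourhood is linked to the base set `B` through `R ∩ V`, which has
        -- positive area.
        obtain ⟨V, hV, hVΩ, h'⟩ := hB y (hRΩ hy)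
        refine ⟨U, mem_nhdsWithin_of_mem_nhds hU, hUfin, ?_⟩
        have : IsFiniteMeasure ((closureMeasure Ω).restrict U) := ⟨by simpa using hUfin⟩
        have : IsFiniteMeasure (volume.restrict (R ∩ V)) :=
          ⟨by simpa using (measure_mono inter_subset_left).trans_lt hRfin⟩
        refine (h.mono le_rfl (Measure.restrict_mono inter_subset_left le_rfl)).trans
          PlaneFun.measurable (fun h0 => ?_)
          (h'.mono (Measure.restrict_mono inter_subset_right le_rfl) le_rfl)
        exact (Measure.measure_pos_of_mem_nhds volume (inter_mem (hRo.mem_nhds hy) hV)).ne'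
          (Measure.restrict_eq_zero.1 h0)
  have fin : IsFiniteMeasure (closureMeasure Ω) :=
    ⟨by rw [← closureMeasure_restrict_closure Ω]; simpa using key.1⟩
  rw [closureMeasure_restrict_closure Ω] at key
  exact ⟨fin, key.2.trans PlaneFun.measurable (by simpa using hB0)
    (key.2.symm PlaneFun.measurable)⟩

/-! ### Slices and the Poincaré–Wirtinger inequality on the cylinder -/

section Slices

variable {ψ : Space → ℝ}

theorem contDiff_slice_left {n : WithTop ℕ∞} (hψ : ContDiff ℝ n ψ) (z : ℝ) :
    ContDiff ℝ n fun x => ψ (x, z) := by fun_prop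

theorem contDiff_slice_right {n : WithTop ℕ∞} (hψ : ContDiff ℝ n ψ) (x : Plane) :
    ContDiff ℝ n fun z => ψ (x, z) := by fun_prop

theorem fderiv_slice_left (hψ : ContDiff ℝ 1 ψ) (y : Space) :
    fderiv ℝ (fun x => ψ (x, y.2)) y.1 = (fderiv ℝ ψ y).comp (ContinuousLinearMap.inl ℝ Plane ℝ) := by
  have h1 : HasFDerivAt ψ (fderiv ℝ ψ y) (y.1, y.2) := (hψ.differentiable one_ne_zero y).hasFDerivAt
  exact (h1.comp y.1 (hasFDerivAt_prodMk_left y.1 y.2)).fderiv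

theorem deriv_slice_right (hψ : ContDiff ℝ 1 ψ) (y : Space) :
    deriv (fun z => ψ (y.1, z)) y.2 = fderiv ℝ ψ y (0, 1) := by
  have h1 : HasFDerivAt ψ (fderiv ℝ ψ y) (y.1, y.2) := (hψ.differentiable one_ne_zero y).hasFDerivAt
  have h2 := (h1.comp y.2 (hasFDerivAt_prodMk_right y.1 y.2)).hasDerivAt.deriv
  simpa [Function.comp_def] using h2

theorem inner_gradient_slice (hψ : ContDiff ℝ 1 ψ) (y : Space) (e : Plane) :
    inner ℝ (gradient (fun x => ψ (x, y.2)) y.1) e = fderiv ℝ ψ y (e, 0) := by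
  rw [gradient, InnerProductSpace.toDual_symm_apply, fderiv_slice_left hψ]
  simp

theorem continuous_gradient_slice (hψ : ContDiff ℝ 1 ψ) :
    Continuous fun y : Space => gradient (fun x => ψ (x, y.2)) y.1 := by
  have : Continuous (fderiv ℝ ψ) := hψ.continuous_fderiv one_ne_zero
  simp only [gradient, fderiv_slice_left hψ]
  fun_prop

theorem continuous_deriv_slice (hψ : ContDiff ℝ 1 ψ) :
    Continuous fun y : Space => deriv (fun z => ψ (y.1, z)) y.2 := by
  have : Continuous (fderiv ℝ ψ) := hψ.continuous_fderiv one_ne_zero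
  simp only [deriv_slice_right hψ]
  fun_prop

end Slices

/-- Continuously differentiable functions on the space. -/
abbrev SpaceFun : Type := {ψ : Space → ℝ // ContDiff ℝ 1 ψ}

theorem SpaceFun.measurable (ψ : SpaceFun) : Measurable ψ.1 := ψ.2.continuous.measurable

/-- The Dirichlet energy on the cylinder. -/
noncomputable def cylinderEnergy (Ω : Set Plane) (z₁ z₂ : ℝ) (ψ : SpaceFun) : ℝ≥0∞ :=
  (∫⁻ y in cylinder Ω z₁ z₂, ‖gradient (fun x => ψ.1 (x, y.2)) y.1‖ₑ ^ 2)
    + ∫⁻ y in cylinder Ω z₁ z₂, ‖deriv (fun z => ψ.1 (y.1, z)) y.2‖ₑ ^ 2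

theorem volume_restrict_cylinder (Ω : Set Plane) (z₁ z₂ : ℝ) :
    volume.restrict (cylinder Ω z₁ z₂) = (volume.restrict Ω).prod (volume.restrict (Ioo z₁ z₂)) := by
  rw [cylinder, Measure.volume_eq_prod, Measure.prod_restrict]

/-- The Poincaré–Wirtinger inequality with boundary values on a cylinder. -/
theorem IsLipschitzDomain.cylinder_poincare {Ω : Set Plane} (hΩ : IsLipschitzDomain Ω) {z₁ z₂ : ℝ}
    (hz : z₁ < z₂) :
    OscControlled (fun ψ : SpaceFun => ψ.1) (cylinderEnergy Ω z₁ z₂)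
      (volume.restrict (cylinder Ω z₁ z₂) + boundaryMeasure Ω z₁ z₂)
      (volume.restrict (cylinder Ω z₁ z₂) + boundaryMeasure Ω z₁ z₂) := by
  obtain ⟨fin, C, hC⟩ := hΩ.poincare
  have finΩ : IsFiniteMeasure (volume.restrict Ω) := ⟨by simpa using hΩ.volume_lt_top⟩
  set κ : Measure ℝ := volume.restrict (Ioo z₁ z₂) + Measure.dirac z₁ + Measure.dirac z₂ with hκ
  set ν := closureMeasure Ω with hν
  set I := volume.restrict (Ioo z₁ z₂) with hI
  have hκI : ∀ᵐ z ∂κ, z ∈ Icc z₁ z₂ := by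
    rw [hκ, ae_add_measure_iff, ae_add_measure_iff]
    refine ⟨⟨?_, by rw [ae_dirac_eq]; exact ⟨le_rfl, hz.le⟩⟩, by rw [ae_dirac_eq]; exact ⟨hz.le, le_rfl⟩⟩
    filter_upwards [ae_restrict_mem measurableSet_Ioo] with z hz using Ioo_subset_Icc_self hz
  -- This pairing is chosen so that axial moves start at points distributed by area on `Ω` and
  -- cross-sectional moves take place at heights distributed by length on the interval. Both costs
  -- then integrate to the energy on the cylinder, even though the endpoints lie on its boundary.
  have hctl : OscControlled (fun ψ : SpaceFun => ψ.1) (cylinderEnergy Ω z₁ z₂)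
      ((volume.restrict Ω).prod κ) (ν.prod I) := by
    refine ⟨(2 * (ν univ * (κ univ * (I univ * ENNReal.ofReal (z₂ - z₁))) + κ univ * C)).toNNReal,
      fun ψ => ?_⟩
    rw [ENNReal.coe_toNNReal (by finiteness)]
    obtain ⟨ψ, hψ⟩ := ψ
    have hψm : Measurable ψ := hψ.continuous.measurable
    have mdz := (continuous_deriv_slice hψ).measurable.enorm.pow_const 2
    have mgr := (continuous_gradient_slice hψ).measurable.enorm.pow_const 2
    refine (lintegral_prod_oscillation_le hψm _ _ _ _).trans ?_
    have t1 : ∫⁻ a, ∫⁻ b, ∫⁻ b', ‖ψ (a, b) - ψ (a, b')‖ₑ ^ 2 ∂I ∂κ ∂(volume.restrict Ω)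
        ≤ (κ univ * (I univ * ENNReal.ofReal (z₂ - z₁))) *
          ∫⁻ y in cylinder Ω z₁ z₂, ‖deriv (fun z => ψ (y.1, z)) y.2‖ₑ ^ 2 := by
      rw [volume_restrict_cylinder, lintegral_prod _ mdz.aemeasurable,
        ← lintegral_const_mul _ mdz.lintegral_prod_right']
      refine lintegral_mono fun a => ?_
      have : ∀ᵐ b ∂κ, ∫⁻ b', ‖ψ (a, b) - ψ (a, b')‖ₑ ^ 2 ∂I ≤
          ENNReal.ofReal (z₂ - z₁) * (∫⁻ z in Ioo z₁ z₂, ‖deriv (fun z => ψ (a, z)) z‖ₑ ^ 2) * I univ := by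
        filter_upwards [hκI] with b hb
        rw [← lintegral_const]
        refine lintegral_mono_ae ?_
        filter_upwards [ae_restrict_mem measurableSet_Ioo] with b' hb'
        exact enorm_sub_sq_le_lintegral_deriv (contDiff_slice_right hψ a) hb
          (Ioo_subset_Icc_self hb')
      refine (lintegral_mono_ae this).trans ?_
      rw [lintegral_const]
      exact le_of_eq (by ring)
    have t2 : ∫⁻ b', ∫⁻ a, ∫⁻ a', ‖ψ (a, b') - ψ (a', b')‖ₑ ^ 2 ∂ν ∂(volume.restrict Ω) ∂I
        ≤ C * ∫⁻ y in cylinder Ω z₁ z₂, ‖gradient (fun x => ψ (x, y.2)) y.1‖ₑ ^ 2 := by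
      rw [volume_restrict_cylinder, lintegral_prod_symm _ mgr.aemeasurable,
        ← lintegral_const_mul _ mgr.lintegral_prod_left']
      refine lintegral_mono fun b => ?_
      have h1 := hC ⟨fun x => ψ (x, b), contDiff_slice_left hψ b⟩
      have h2 : volume.restrict Ω ≤ ν := by
        rw [hν, closureMeasure]; exact Measure.le_add_right le_rfl
      refine (lintegral_mono' h2 le_rfl).trans (h1.trans_eq ?_)
      rw [dirichletEnergy]
      congr 1
      refine lintegral_congr fun x => ?_
      rw [gradient, ← enorm_norm, ← enorm_norm ((InnerProductSpace.toDual ℝ Plane).symm _),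
        LinearIsometryEquiv.norm_map]
    calc _ ≤ 2 * (ν univ * ((κ univ * (I univ * ENNReal.ofReal (z₂ - z₁))) *
          cylinderEnergy Ω z₁ z₂ ⟨ψ, hψ⟩) + κ univ * (C * cylinderEnergy Ω z₁ z₂ ⟨ψ, hψ⟩)) := by
          gcongr
          · refine t1.trans ?_
            gcongr
            exact le_add_self
          · refine t2.trans ?_
            gcongr
            exact le_self_add
      _ = _ := by ring
  set α := (volume.restrict Ω).prod κ
  set β := ν.prod I
  -- `α` carries the volume and the two ends, `β` the volume once more and the lateral part.
  have hle : volume.restrict (cylinder Ω z₁ z₂) + boundaryMeasure Ω z₁ z₂ ≤ α + β := by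
    have finfr : IsFiniteMeasure ((Measure.hausdorffMeasure 1).restrict (frontier Ω)) :=
      isFiniteMeasure_of_le ν (by rw [hν, closureMeasure]; exact Measure.le_add_left le_rfl)
    rw [volume_restrict_cylinder, boundaryMeasure]
    simp only [α, β, hκ, hν, closureMeasure, Measure.prod_add, Measure.add_prod]
    calc _ ≤ _ := Measure.le_add_right (ν' := (volume.restrict Ω).prod I) le_rfl
      _ = _ := by abel
  have hΩ0 : volume Ω ≠ 0 := hΩ.isOpen.measure_ne_zero _ hΩ.isConnected.nonempty
  have hI0 : I univ ≠ 0 := by simp [hI, hz]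
  have hα : α ≠ 0 := by
    rw [← Measure.measure_univ_ne_zero, ← univ_prod_univ, Measure.prod_prod]
    simp [hΩ0, hκ]
  have hβ : β ≠ 0 := by
    rw [← Measure.measure_univ_ne_zero, ← univ_prod_univ, Measure.prod_prod]
    refine mul_ne_zero ?_ hI0
    simp [hν, closureMeasure, hΩ0]
  have hsym := hctl.symm SpaceFun.measurable
  -- The remaining pairings come by transitivity: `α` with itself through `β`, and `β` with itself
  -- through `α`.
  have h1 : OscControlled (fun ψ : SpaceFun => ψ.1) (cylinderEnergy Ω z₁ z₂) (α + β) α :=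
    (hctl.trans SpaceFun.measurable hβ hsym).add_left hsym
  have h2 := (hsym.trans SpaceFun.measurable hα hctl)
  have h3 := h1.symm SpaceFun.measurable
  have h4 := (hctl.add_left h2).symm SpaceFun.measurable
  exact ((h3.add_left h4)).mono hle hle

/-! ### From oscillation to the Friedrichs inequality -/

section Friedrichs

variable {X ι : Type*} [MeasurableSpace X] {F : ι → X → ℝ} {E : ι → ℝ≥0∞} {μ ν : Measure X}

theorem OscControlled.smul_right (h : OscControlled F E μ ν) (c : ℝ≥0) :
    OscControlled F E μ ((c : ℝ≥0∞) • ν) := by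
  obtain ⟨C, hC⟩ := h
  refine ⟨c * C, fun i => ?_⟩
  simp only [lintegral_smul_measure, smul_eq_mul]
  rw [lintegral_const_mul' _ _ (by simp), ENNReal.coe_mul, mul_assoc]
  gcongr
  exact hC i

/-- The Friedrichs inequality. -/
theorem OscControlled.friedrichs [IsFiniteMeasure μ] [IsFiniteMeasure ν]
    (h : OscControlled F E μ ν) (hF : ∀ i, Measurable (F i)) (hν : ν ≠ 0) :
    ∃ C : ℝ≥0, ∀ i, ∫⁻ x, ‖F i x‖ₑ ^ 2 ∂μ ≤ C * (E i + ∫⁻ x, ‖F i x‖ₑ ^ 2 ∂ν) := by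
  obtain ⟨C, hC⟩ := h
  have hν0 : ν univ ≠ 0 := by simpa using hν
  have hνt : ν univ ≠ ⊤ := measure_ne_top _ _
  have hμt : μ univ ≠ ⊤ := measure_ne_top _ _
  have key : ∀ i, ν univ * ∫⁻ x, ‖F i x‖ₑ ^ 2 ∂μ
      ≤ (2 * (C + μ univ)) * (E i + ∫⁻ x, ‖F i x‖ₑ ^ 2 ∂ν) := by
    intro i
    have hm := hF i
    calc ν univ * ∫⁻ x, ‖F i x‖ₑ ^ 2 ∂μ = ∫⁻ x, ∫⁻ _, ‖F i x‖ₑ ^ 2 ∂ν ∂μ := by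
          simp only [lintegral_const]
          rw [lintegral_mul_const _ (by fun_prop), mul_comm]
      _ ≤ ∫⁻ x, ∫⁻ y, 2 * (‖F i x - F i y‖ₑ ^ 2 + ‖F i y‖ₑ ^ 2) ∂ν ∂μ := by
          refine lintegral_mono fun x => lintegral_mono fun y => ?_
          simpa using enorm_sub_sq_le (F i x) (F i y) 0
      _ = 2 * ((∫⁻ x, ∫⁻ y, ‖F i x - F i y‖ₑ ^ 2 ∂ν ∂μ) + (∫⁻ y, ‖F i y‖ₑ ^ 2 ∂ν) * μ univ) := by
          simp_rw [lintegral_const_mul' 2 _ (by simp : (2 : ℝ≥0∞) ≠ ⊤)]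
          congr 1
          rw [← lintegral_const, ← lintegral_add_right _ measurable_const]
          refine lintegral_congr fun x => ?_
          rw [lintegral_add_right _ (by fun_prop)]
      _ ≤ 2 * (C * E i + (∫⁻ y, ‖F i y‖ₑ ^ 2 ∂ν) * μ univ) := by
          gcongr
          exact hC i
      _ ≤ 2 * ((C * E i + C * ∫⁻ x, ‖F i x‖ₑ ^ 2 ∂ν)
            + (μ univ * E i + μ univ * ∫⁻ y, ‖F i y‖ₑ ^ 2 ∂ν)) := by
          gcongr
          · exact le_self_add
          · rw [mul_comm]; exact le_add_self
      _ = _ := by ring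
  refine ⟨((ν univ)⁻¹ * (2 * (C + μ univ))).toNNReal, fun i => ?_⟩
  rw [ENNReal.coe_toNNReal (by finiteness), mul_assoc]
  calc _ = (ν univ)⁻¹ * (ν univ * ∫⁻ x, ‖F i x‖ₑ ^ 2 ∂μ) := by
        rw [← mul_assoc, ENNReal.inv_mul_cancel hν0 hνt, one_mul]
    _ ≤ _ := mul_le_mul' le_rfl (key i)

end Friedrichs

/-! ### The surface measure and its parts -/

section BoundaryMeasure

variable {Ω : Set Plane} {z₁ z₂ : ℝ}

theorem IsLipschitzDomain.isFiniteMeasure_volume (hΩ : IsLipschitzDomain Ω) :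
    IsFiniteMeasure (volume.restrict Ω) := ⟨by simpa using hΩ.volume_lt_top⟩

theorem IsLipschitzDomain.isFiniteMeasure_frontier (hΩ : IsLipschitzDomain Ω) :
    IsFiniteMeasure ((Measure.hausdorffMeasure 1).restrict (frontier Ω)) := by
  have := hΩ.poincare.1
  exact isFiniteMeasure_of_le (closureMeasure Ω) (Measure.le_add_left le_rfl)

theorem IsLipschitzDomain.isFiniteMeasure_boundaryMeasure (hΩ : IsLipschitzDomain Ω) :
    IsFiniteMeasure (boundaryMeasure Ω z₁ z₂) := by
  have := hΩ.isFiniteMeasure_volume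
  have := hΩ.isFiniteMeasure_frontier
  rw [boundaryMeasure]
  infer_instance

theorem IsLipschitzDomain.isFiniteMeasure_cylinder (hΩ : IsLipschitzDomain Ω) :
    IsFiniteMeasure (volume.restrict (cylinder Ω z₁ z₂)) := by
  have := hΩ.isFiniteMeasure_volume
  rw [volume_restrict_cylinder]
  infer_instance

/-- The two end terms vanish because their Dirac masses sit at the endpoints, outside the open
interval. -/
theorem IsLipschitzDomain.boundaryMeasure_restrict_lateral (hΩ : IsLipschitzDomain Ω)
    {G : Set Plane} (hG : G ⊆ frontier Ω) :
    (boundaryMeasure Ω z₁ z₂).restrict (G ×ˢ Ioo z₁ z₂)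
      = ((Measure.hausdorffMeasure 1).restrict G).prod (volume.restrict (Ioo z₁ z₂)) := by
  have := hΩ.isFiniteMeasure_volume
  have := hΩ.isFiniteMeasure_frontier
  rw [boundaryMeasure, Measure.restrict_add, Measure.restrict_add, ← Measure.prod_restrict,
    ← Measure.prod_restrict, ← Measure.prod_restrict, restrict_dirac' measurableSet_Ioo,
    restrict_dirac' measurableSet_Ioo, if_neg (by simp), if_neg (by simp),
    Measure.restrict_restrict_of_subset hG, Measure.restrict_restrict_of_subset Subset.rfl]
  simp

theorem IsLipschitzDomain.restrict_frontier_restrict_self (hΩ : IsLipschitzDomain Ω)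
    (μ : Measure Plane) : (μ.restrict (frontier Ω)).restrict Ω = 0 := by
  rw [Measure.restrict_restrict hΩ.isOpen.measurableSet, hΩ.isOpen.frontier_eq,
    inter_sdiff_self, Measure.restrict_empty]

theorem IsLipschitzDomain.boundaryMeasure_restrict_inlet (hΩ : IsLipschitzDomain Ω)
    (hz : z₁ < z₂) : (boundaryMeasure Ω z₁ z₂).restrict (Ω ×ˢ {z₁})
      = (volume.restrict Ω).prod (Measure.dirac z₁) := by
  have := hΩ.isFiniteMeasure_volume
  have := hΩ.isFiniteMeasure_frontier
  rw [boundaryMeasure, Measure.restrict_add, Measure.restrict_add, ← Measure.prod_restrict,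
    ← Measure.prod_restrict, ← Measure.prod_restrict,
    restrict_dirac' (measurableSet_singleton z₁),
    restrict_dirac' (measurableSet_singleton z₁), if_pos (mem_singleton _), if_neg (by simp [hz.ne']),
    Measure.restrict_restrict_of_subset Subset.rfl, hΩ.restrict_frontier_restrict_self]
  simp

theorem IsLipschitzDomain.boundaryMeasure_restrict_outlet (hΩ : IsLipschitzDomain Ω)
    (hz : z₁ < z₂) : (boundaryMeasure Ω z₁ z₂).restrict (Ω ×ˢ {z₂})
      = (volume.restrict Ω).prod (Measure.dirac z₂) := by
  have := hΩ.isFiniteMeasure_volume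
  have := hΩ.isFiniteMeasure_frontier
  rw [boundaryMeasure, Measure.restrict_add, Measure.restrict_add, ← Measure.prod_restrict,
    ← Measure.prod_restrict, ← Measure.prod_restrict,
    restrict_dirac' (measurableSet_singleton z₂),
    restrict_dirac' (measurableSet_singleton z₂), if_neg (by simp [hz.ne]), if_pos (mem_singleton _),
    Measure.restrict_restrict_of_subset Subset.rfl, hΩ.restrict_frontier_restrict_self]
  simp

/-- Extended by zero, a coefficient of the cross section becomes a bounded weight for the whole
surface measure, so that end integrals are weighted inner products of traces. -/
theorem IsLipschitzDomain.memLp_top_inlet (hΩ : IsLipschitzDomain Ω) (hz : z₁ < z₂)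
    {f : Plane → ℝ} (hf : MemLp f ⊤ (volume.restrict Ω)) :
    MemLp ((Ω ×ˢ {z₁}).indicator fun y => f y.1) ⊤ (boundaryMeasure Ω z₁ z₂) := by
  have := hΩ.isFiniteMeasure_volume
  rw [memLp_indicator_iff_restrict (hΩ.isOpen.measurableSet.prod (measurableSet_singleton z₁)),
    hΩ.boundaryMeasure_restrict_inlet hz]
  exact hf.comp_fst _

theorem IsLipschitzDomain.memLp_top_outlet (hΩ : IsLipschitzDomain Ω) (hz : z₁ < z₂)
    {f : Plane → ℝ} (hf : MemLp f ⊤ (volume.restrict Ω)) :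
    MemLp ((Ω ×ˢ {z₂}).indicator fun y => f y.1) ⊤ (boundaryMeasure Ω z₁ z₂) := by
  have := hΩ.isFiniteMeasure_volume
  rw [memLp_indicator_iff_restrict (hΩ.isOpen.measurableSet.prod (measurableSet_singleton z₂)),
    hΩ.boundaryMeasure_restrict_outlet hz]
  exact hf.comp_fst _

theorem IsLipschitzDomain.memLp_top_lateral (hΩ : IsLipschitzDomain Ω)
    {G : Set Plane} (hG : G ⊆ frontier Ω) (hGm : MeasurableSet G)
    {f : Plane → ℝ} (hf : MemLp f ⊤ ((Measure.hausdorffMeasure 1).restrict G)) :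
    MemLp ((G ×ˢ Ioo z₁ z₂).indicator fun y => f y.1) ⊤ (boundaryMeasure Ω z₁ z₂) := by
  rw [memLp_indicator_iff_restrict (hGm.prod measurableSet_Ioo),
    hΩ.boundaryMeasure_restrict_lateral hG]
  exact hf.comp_fst _

theorem memLp_top_cylinder
    {f : Plane → ℝ} (hf : MemLp f ⊤ (volume.restrict Ω)) :
    MemLp (fun y : Space => f y.1) ⊤ (volume.restrict (cylinder Ω z₁ z₂)) := by
  rw [volume_restrict_cylinder]
  exact hf.comp_fst _

theorem ae_cylinder {p : Plane → Prop}
    (h : ∀ᵐ x ∂volume.restrict Ω, p x) :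
    ∀ᵐ y ∂volume.restrict (cylinder Ω z₁ z₂), p y.1 := by
  rw [volume_restrict_cylinder]
  exact Measure.quasiMeasurePreserving_fst.ae h

/-- Translations are isometries and preserve length. This makes the periodicity condition
independent of the representative of the trace. -/
theorem IsLipschitzDomain.quasiMeasurePreserving_shift (hΩ : IsLipschitzDomain Ω)
    {A : Set Plane} {p : Plane} (hA : A ⊆ frontier Ω) (hAp : (fun x => x + p) '' A ⊆ frontier Ω) :
    Measure.QuasiMeasurePreserving (fun y : Space => (y.1 + p, y.2))
      ((boundaryMeasure Ω z₁ z₂).restrict (A ×ˢ Ioo z₁ z₂)) (boundaryMeasure Ω z₁ z₂) := by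
  have := hΩ.isFiniteMeasure_frontier
  have finA : IsFiniteMeasure ((Measure.hausdorffMeasure 1 : Measure Plane).restrict A) :=
    isFiniteMeasure_of_le _ (Measure.restrict_mono hA le_rfl)
  have h1 : Measure.QuasiMeasurePreserving (fun x : Plane => x + p)
      ((Measure.hausdorffMeasure 1).restrict A)
      ((Measure.hausdorffMeasure 1).restrict (frontier Ω)) := by
    refine ⟨by fun_prop, Measure.AbsolutelyContinuous.mk fun s hs h0 => ?_⟩
    have hm : Measurable fun x : Plane => x + p := by fun_prop
    rw [Measure.map_apply hm hs, Measure.restrict_apply (hm hs)]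
    rw [Measure.restrict_apply hs] at h0
    rw [← (IsometryEquiv.addRight p).isometry.hausdorffMeasure_image (Or.inl zero_le_one)]
    refine measure_mono_null ?_ h0
    rintro _ ⟨x, ⟨hx, hxA⟩, rfl⟩
    exact ⟨hx, hAp ⟨x, hxA, rfl⟩⟩
  have h2 := QuasiMeasurePreserving.prodMap h1
    (Measure.QuasiMeasurePreserving.id (volume.restrict (Ioo z₁ z₂)))
  rw [hΩ.boundaryMeasure_restrict_lateral hA]
  refine h2.mono_right ?_
  rw [boundaryMeasure, add_assoc]
  exact (Measure.le_add_right le_rfl).absolutelyContinuous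

end BoundaryMeasure

theorem enorm_sq_eq_lintegral {α E : Type*} [MeasurableSpace α] {μ : Measure α}
    [NormedAddCommGroup E] (u : Lp E 2 μ) : ‖u‖ₑ ^ 2 = ∫⁻ x, ‖u x‖ₑ ^ 2 ∂μ := by
  have h := eLpNorm_nnreal_pow_eq_lintegral (μ := μ) (f := u) (p := 2) two_ne_zero
  rw [Lp.enorm_def]
  simpa using h

/-! ### Weighted `L²` inner products -/

section Weighted

variable {α E : Type*} [MeasurableSpace α] {μ : Measure α} [NormedAddCommGroup E]
  [InnerProductSpace ℝ E]

/-- Multiplication by an essentially bounded function on `L²`. -/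
noncomputable def mulOp (f : α → ℝ) (hf : MemLp f ⊤ μ) : Lp E 2 μ →L[ℝ] Lp E 2 μ :=
  (ContinuousLinearMap.lsmul ℝ ℝ : ℝ →L[ℝ] E →L[ℝ] E).holderL μ ⊤ 2 2 (hf.toLp f)

theorem coeFn_mulOp {f : α → ℝ} (hf : MemLp f ⊤ μ) (u : Lp E 2 μ) :
    mulOp f hf u =ᵐ[μ] fun x => f x • u x := by
  filter_upwards [(ContinuousLinearMap.lsmul ℝ ℝ : ℝ →L[ℝ] E →L[ℝ] E).coeFn_holder (r := 2)
    (hf.toLp f) u, hf.coeFn_toLp] with x h1 h2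
  exact h1.trans (by simp [h2])

/-- The `L²` inner product weighted by an essentially bounded function. -/
noncomputable def weightedInner (f : α → ℝ) (hf : MemLp f ⊤ μ) :
    Lp E 2 μ →L[ℝ] Lp E 2 μ →L[ℝ] ℝ :=
  (innerSL ℝ : Lp E 2 μ →L[ℝ] Lp E 2 μ →L[ℝ] ℝ).comp (mulOp f hf)

theorem integrable_weighted {f : α → ℝ} (hf : MemLp f ⊤ μ) (u v : Lp E 2 μ) :
    Integrable (fun x => f x * inner ℝ (u x) (v x)) μ := by
  refine (L2.integrable_inner (𝕜 := ℝ) (mulOp f hf u) v).congr ?_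
  filter_upwards [coeFn_mulOp hf u] with x hx
  rw [hx, real_inner_smul_left]

theorem weightedInner_apply {f : α → ℝ} (hf : MemLp f ⊤ μ) (u v : Lp E 2 μ) :
    weightedInner f hf u v = ∫ x, f x * inner ℝ (u x) (v x) ∂μ := by
  change inner ℝ (mulOp f hf u) v = _
  rw [L2.inner_def]
  refine integral_congr_ae ?_
  filter_upwards [coeFn_mulOp hf u] with x hx
  rw [hx, real_inner_smul_left]

theorem weightedInner_self_ge {f : α → ℝ} (hf : MemLp f ⊤ μ) {m : ℝ} (h : ∀ᵐ x ∂μ, m ≤ f x)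
    (u : Lp E 2 μ) : m * ‖u‖ ^ 2 ≤ weightedInner f hf u u := by
  rw [weightedInner_apply, ← real_inner_self_eq_norm_sq, L2.inner_def, ← integral_const_mul]
  refine integral_mono_ae ((L2.integrable_inner u u).const_mul m) (integrable_weighted hf u u) ?_
  filter_upwards [h] with x hx
  exact mul_le_mul_of_nonneg_right hx real_inner_self_nonneg

/-- The sign of the weight matters only where `u` does not vanish; the inflow condition enters in
this form. -/
theorem weightedInner_self_nonneg {f : α → ℝ} (hf : MemLp f ⊤ μ) {u : Lp E 2 μ}
    (h : ∀ᵐ x ∂μ, u x = 0 ∨ 0 ≤ f x) : 0 ≤ weightedInner f hf u u := by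
  rw [weightedInner_apply]
  refine integral_nonneg_of_ae ?_
  filter_upwards [h] with x hx
  rcases hx with hx | hx
  · simp [hx]
  · exact mul_nonneg hx real_inner_self_nonneg

theorem weightedInner_self_nonpos {f : α → ℝ} (hf : MemLp f ⊤ μ) {u : Lp E 2 μ}
    (h : ∀ᵐ x ∂μ, u x = 0 ∨ f x ≤ 0) : weightedInner f hf u u ≤ 0 := by
  rw [weightedInner_apply]
  refine integral_nonpos_of_ae ?_
  filter_upwards [h] with x hx
  rcases hx with hx | hx
  · simp [hx]
  · exact mul_nonpos_of_nonpos_of_nonneg hx real_inner_self_nonneg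

theorem ofReal_weightedInner_self {f : α → ℝ} (hf : MemLp f ⊤ μ) (h : ∀ᵐ x ∂μ, 0 ≤ f x)
    (u : Lp E 2 μ) :
    ENNReal.ofReal (weightedInner f hf u u) = ∫⁻ x, ENNReal.ofReal (f x) * ‖u x‖ₑ ^ 2 ∂μ := by
  rw [weightedInner_apply, ofReal_integral_eq_lintegral_ofReal (integrable_weighted hf u u)]
  · refine lintegral_congr_ae ?_
    filter_upwards [h] with x hx
    rw [ENNReal.ofReal_mul hx, real_inner_self_eq_norm_sq, ENNReal.ofReal_pow (norm_nonneg _),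
      ofReal_norm]
  · filter_upwards [h] with x hx
    exact mul_nonneg hx real_inner_self_nonneg

end Weighted

/-! ### The Hilbert space of functions with derivatives and traces -/

/-- The Hilbert space of quadruples: function, cross-sectional gradient, axial derivative and
boundary values. -/
def DataSpace (Ω : Set Plane) (z₁ z₂ : ℝ) : Type :=
  WithLp 2 (Lp ℝ 2 (volume.restrict (cylinder Ω z₁ z₂)) ×
    WithLp 2 (Lp Plane 2 (volume.restrict (cylinder Ω z₁ z₂)) ×
      WithLp 2 (Lp ℝ 2 (volume.restrict (cylinder Ω z₁ z₂)) × Lp ℝ 2 (boundaryMeasure Ω z₁ z₂))))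

namespace DataSpace

variable {Ω : Set Plane} {z₁ z₂ : ℝ}

noncomputable instance : NormedAddCommGroup (DataSpace Ω z₁ z₂) :=
  inferInstanceAs (NormedAddCommGroup (WithLp 2 (_ × WithLp 2 (_ × WithLp 2 (_ × _)))))

noncomputable instance : InnerProductSpace ℝ (DataSpace Ω z₁ z₂) :=
  inferInstanceAs (InnerProductSpace ℝ (WithLp 2 (_ × WithLp 2 (_ × WithLp 2 (_ × _)))))

instance : CompleteSpace (DataSpace Ω z₁ z₂) :=
  inferInstanceAs (CompleteSpace (WithLp 2 (_ × WithLp 2 (_ × WithLp 2 (_ × _)))))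

/-- The function component. -/
noncomputable def valL : DataSpace Ω z₁ z₂ →L[ℝ] Lp ℝ 2 (volume.restrict (cylinder Ω z₁ z₂)) :=
  WithLp.fstL 2 ℝ _ _

/-- The cross-sectional gradient component. -/
noncomputable def gradL :
    DataSpace Ω z₁ z₂ →L[ℝ] Lp Plane 2 (volume.restrict (cylinder Ω z₁ z₂)) :=
  (WithLp.fstL 2 ℝ _ _).comp (WithLp.sndL 2 ℝ _ _)

/-- The axial derivative component. -/
noncomputable def dzL : DataSpace Ω z₁ z₂ →L[ℝ] Lp ℝ 2 (volume.restrict (cylinder Ω z₁ z₂)) :=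
  (WithLp.fstL 2 ℝ _ _).comp ((WithLp.sndL 2 ℝ _ _).comp (WithLp.sndL 2 ℝ _ _))

/-- The boundary value component. -/
noncomputable def traceL : DataSpace Ω z₁ z₂ →L[ℝ] Lp ℝ 2 (boundaryMeasure Ω z₁ z₂) :=
  (WithLp.sndL 2 ℝ _ _).comp ((WithLp.sndL 2 ℝ _ _).comp (WithLp.sndL 2 ℝ _ _))

/-- The quadruple with given components. -/
noncomputable def mk (u : Lp ℝ 2 (volume.restrict (cylinder Ω z₁ z₂)))
    (v : Lp Plane 2 (volume.restrict (cylinder Ω z₁ z₂)))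
    (w : Lp ℝ 2 (volume.restrict (cylinder Ω z₁ z₂))) (g : Lp ℝ 2 (boundaryMeasure Ω z₁ z₂)) :
    DataSpace Ω z₁ z₂ :=
  WithLp.toLp 2 (u, WithLp.toLp 2 (v, WithLp.toLp 2 (w, g)))

theorem norm_sq (X : DataSpace Ω z₁ z₂) :
    ‖X‖ ^ 2 = ‖valL X‖ ^ 2 + ‖gradL X‖ ^ 2 + ‖dzL X‖ ^ 2 + ‖traceL X‖ ^ 2 := by
  refine (WithLp.prod_norm_sq_eq_of_L2 _).trans ?_
  rw [WithLp.prod_norm_sq_eq_of_L2, WithLp.prod_norm_sq_eq_of_L2, ← add_assoc, ← add_assoc]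
  rfl

theorem tendsto_iff {ι : Type*} {l : Filter ι} {X : ι → DataSpace Ω z₁ z₂} {Y : DataSpace Ω z₁ z₂} :
    Tendsto X l (𝓝 Y) ↔ Tendsto (fun i => valL (X i)) l (𝓝 (valL Y)) ∧
      Tendsto (fun i => gradL (X i)) l (𝓝 (gradL Y)) ∧
      Tendsto (fun i => dzL (X i)) l (𝓝 (dzL Y)) ∧
      Tendsto (fun i => traceL (X i)) l (𝓝 (traceL Y)) := by
  constructor
  · exact fun h => ⟨(valL.continuous.tendsto _).comp h, (gradL.continuous.tendsto _).comp h,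
      (dzL.continuous.tendsto _).comp h, (traceL.continuous.tendsto _).comp h⟩
  · rintro ⟨h1, h2, h3, h4⟩
    have c3 := ((WithLp.prod_continuous_toLp 2 _ _).tendsto (dzL Y, traceL Y)).comp
      (h3.prodMk_nhds h4)
    have c2 := ((WithLp.prod_continuous_toLp 2 _ _).tendsto _).comp (h2.prodMk_nhds c3)
    exact ((WithLp.prod_continuous_toLp 2 _ _).tendsto _).comp (h1.prodMk_nhds c2)

/-- The components of `X` are almost everywhere equal to the given functions. -/
structure Represents (X : DataSpace Ω z₁ z₂) (u : Space → ℝ) (v : Space → Plane) (w g : Space → ℝ) :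
    Prop where
  val : valL X =ᵐ[volume.restrict (cylinder Ω z₁ z₂)] u
  grad : gradL X =ᵐ[volume.restrict (cylinder Ω z₁ z₂)] v
  dz : dzL X =ᵐ[volume.restrict (cylinder Ω z₁ z₂)] w
  trace : traceL X =ᵐ[boundaryMeasure Ω z₁ z₂] g

theorem represents_mk {u : Space → ℝ} {v : Space → Plane} {w g : Space → ℝ}
    (hu : MemLp u 2 (volume.restrict (cylinder Ω z₁ z₂)))
    (hv : MemLp v 2 (volume.restrict (cylinder Ω z₁ z₂)))
    (hw : MemLp w 2 (volume.restrict (cylinder Ω z₁ z₂)))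
    (hg : MemLp g 2 (boundaryMeasure Ω z₁ z₂)) :
    Represents (mk (hu.toLp u) (hv.toLp v) (hw.toLp w) (hg.toLp g)) u v w g :=
  ⟨hu.coeFn_toLp, hv.coeFn_toLp, hw.coeFn_toLp, hg.coeFn_toLp⟩

theorem Represents.add {X X' : DataSpace Ω z₁ z₂} {u u' : Space → ℝ} {v v' : Space → Plane}
    {w g w' g' : Space → ℝ} (h : Represents X u v w g) (h' : Represents X' u' v' w' g') :
    Represents (X + X') (u + u') (v + v') (w + w') (g + g') := by
  refine ⟨?_, ?_, ?_, ?_⟩ <;> rw [map_add]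
  exacts [(Lp.coeFn_add _ _).trans (h.val.add h'.val), (Lp.coeFn_add _ _).trans (h.grad.add h'.grad),
    (Lp.coeFn_add _ _).trans (h.dz.add h'.dz), (Lp.coeFn_add _ _).trans (h.trace.add h'.trace)]

theorem Represents.smul {X : DataSpace Ω z₁ z₂} {u : Space → ℝ} {v : Space → Plane}
    {w g : Space → ℝ} (h : Represents X u v w g) (c : ℝ) :
    Represents (c • X) (c • u) (c • v) (c • w) (c • g) := by
  refine ⟨?_, ?_, ?_, ?_⟩ <;> rw [map_smul]
  exacts [(Lp.coeFn_smul _ _).trans (h.val.const_smul c),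
    (Lp.coeFn_smul _ _).trans (h.grad.const_smul c),
    (Lp.coeFn_smul _ _).trans (h.dz.const_smul c), (Lp.coeFn_smul _ _).trans (h.trace.const_smul c)]

theorem represents_self (X : DataSpace Ω z₁ z₂) :
    Represents X (valL X) (gradL X) (dzL X) (traceL X) :=
  ⟨EventuallyEq.rfl, EventuallyEq.rfl, EventuallyEq.rfl, EventuallyEq.rfl⟩

end DataSpace

open DataSpace

/-! ### Smooth data, their closure, and `H¹` functions with trace -/

variable {Ω : Set Plane} {z₁ z₂ : ℝ}

/-- The cross-sectional gradient of a smooth function. -/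
noncomputable def sliceGrad (ψ : Space → ℝ) : Space → Plane :=
  fun y => gradient (fun x => ψ (x, y.2)) y.1

/-- The axial derivative of a smooth function. -/
noncomputable def sliceDeriv (ψ : Space → ℝ) : Space → ℝ :=
  fun y => deriv (fun z => ψ (y.1, z)) y.2

theorem contDiff_one_of_infty {ψ : Space → ℝ} (hψ : ContDiff ℝ ∞ ψ) : ContDiff ℝ 1 ψ :=
  hψ.of_le (by norm_cast)

theorem inner_sliceGrad {ψ : Space → ℝ} (hψ : ContDiff ℝ 1 ψ) (y : Space) (e : Plane) :
    inner ℝ (sliceGrad ψ y) e = fderiv ℝ ψ y (e, 0) := inner_gradient_slice hψ y e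

theorem sliceDeriv_apply {ψ : Space → ℝ} (hψ : ContDiff ℝ 1 ψ) (y : Space) :
    sliceDeriv ψ y = fderiv ℝ ψ y (0, 1) := deriv_slice_right hψ y

theorem sliceGrad_add {ψ φ : Space → ℝ} (hψ : ContDiff ℝ 1 ψ) (hφ : ContDiff ℝ 1 φ) :
    sliceGrad (ψ + φ) = sliceGrad ψ + sliceGrad φ := by
  funext y
  refine ext_inner_right ℝ fun e => ?_
  rw [Pi.add_apply, inner_add_left, inner_sliceGrad hψ, inner_sliceGrad hφ,
    inner_sliceGrad (ψ := ψ + φ) (hψ.add hφ),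
    fderiv_add (hψ.differentiable one_ne_zero y) (hφ.differentiable one_ne_zero y)]
  rfl

theorem sliceGrad_smul {ψ : Space → ℝ} (hψ : ContDiff ℝ 1 ψ) (c : ℝ) :
    sliceGrad (c • ψ) = c • sliceGrad ψ := by
  funext y
  refine ext_inner_right ℝ fun e => ?_
  rw [Pi.smul_apply, real_inner_smul_left, inner_sliceGrad hψ, inner_sliceGrad (ψ := c • ψ) (hψ.const_smul c),
    fderiv_const_smul (hψ.differentiable one_ne_zero y)]
  rfl

theorem sliceDeriv_add {ψ φ : Space → ℝ} (hψ : ContDiff ℝ 1 ψ) (hφ : ContDiff ℝ 1 φ) :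
    sliceDeriv (ψ + φ) = sliceDeriv ψ + sliceDeriv φ := by
  funext y
  rw [Pi.add_apply, sliceDeriv_apply hψ, sliceDeriv_apply hφ, sliceDeriv_apply (ψ := ψ + φ) (hψ.add hφ),
    fderiv_add (hψ.differentiable one_ne_zero y) (hφ.differentiable one_ne_zero y)]
  rfl

theorem sliceDeriv_smul {ψ : Space → ℝ} (hψ : ContDiff ℝ 1 ψ) (c : ℝ) :
    sliceDeriv (c • ψ) = c • sliceDeriv ψ := by
  funext y
  rw [Pi.smul_apply, sliceDeriv_apply hψ, sliceDeriv_apply (ψ := c • ψ) (hψ.const_smul c),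
    fderiv_const_smul (hψ.differentiable one_ne_zero y)]
  rfl

variable (Ω z₁ z₂) in
/-- The quadruples coming from functions smooth up to the boundary. -/
def smoothData : Submodule ℝ (DataSpace Ω z₁ z₂) where
  carrier := {X | ∃ ψ : Space → ℝ, ContDiff ℝ ∞ ψ ∧
    Represents X ψ (sliceGrad ψ) (sliceDeriv ψ) ψ}
  add_mem' := by
    rintro X Y ⟨ψ, hψ, hX⟩ ⟨φ, hφ, hY⟩
    refine ⟨ψ + φ, hψ.add hφ, ?_⟩
    rw [sliceGrad_add (contDiff_one_of_infty hψ) (contDiff_one_of_infty hφ),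
      sliceDeriv_add (contDiff_one_of_infty hψ) (contDiff_one_of_infty hφ)]
    exact hX.add hY
  zero_mem' := by
    refine ⟨0, contDiff_const, ?_⟩
    have h1 : sliceGrad 0 = 0 := by
      simpa using sliceGrad_smul (ψ := 0) contDiff_const 0
    have h2 : sliceDeriv 0 = 0 := by
      simpa using sliceDeriv_smul (ψ := 0) contDiff_const 0
    rw [h1, h2]
    simpa using (represents_self (0 : DataSpace Ω z₁ z₂)).smul 0
  smul_mem' := by
    rintro c X ⟨ψ, hψ, hX⟩
    refine ⟨c • ψ, hψ.const_smul c, ?_⟩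
    rw [sliceGrad_smul (contDiff_one_of_infty hψ), sliceDeriv_smul (contDiff_one_of_infty hψ)]
    exact hX.smul c

variable (Ω z₁ z₂) in
/-- The quadruples that consist of an `H¹` function, its derivatives and its trace. -/
noncomputable def traceData : Submodule ℝ (DataSpace Ω z₁ z₂) := (smoothData Ω z₁ z₂).topologicalClosure

theorem isClosed_traceData : IsClosed (traceData Ω z₁ z₂ : Set (DataSpace Ω z₁ z₂)) :=
  Submodule.isClosed_topologicalClosure _

/-- A closed condition satisfied by smooth functions passes to the closure. -/
theorem traceData_induction {p : DataSpace Ω z₁ z₂ → Prop} (hp : IsClosed {X | p X})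
    (h : ∀ (X : DataSpace Ω z₁ z₂) (ψ : Space → ℝ), ContDiff ℝ ∞ ψ →
      Represents X ψ (sliceGrad ψ) (sliceDeriv ψ) ψ → p X)
    {X : DataSpace Ω z₁ z₂} (hX : X ∈ traceData Ω z₁ z₂) : p X := by
  have : closure (smoothData Ω z₁ z₂ : Set (DataSpace Ω z₁ z₂)) ⊆ {X | p X} :=
    closure_minimal (fun Y ⟨ψ, hψ, hY⟩ => h Y ψ hψ hY) hp
  exact this hX

/-- `HasTrace` does not ask its approximants to be square integrable; they are as soon as their
distance to the limit is below `1`. -/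
theorem eventually_memLp_of_tendsto {α E : Type*} [MeasurableSpace α] [NormedAddCommGroup E]
    {μ : Measure α} {f : ℕ → α → E} {g : α → E} (hf : ∀ n, AEStronglyMeasurable (f n) μ)
    (hg : MemLp g 2 μ) (h : Tendsto (fun n => eLpNorm (fun y => f n y - g y) 2 μ) atTop (𝓝 0)) :
    ∀ᶠ n in atTop, MemLp (f n) 2 μ := by
  filter_upwards [h.eventually_lt_const zero_lt_one] with n hn
  have h1 : MemLp (f n - g) 2 μ := ⟨(hf n).sub hg.1, hn.trans ENNReal.one_lt_top⟩
  simpa using h1.add hg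

theorem tendsto_Lp_of_ae_eq {α E : Type*} [MeasurableSpace α] [NormedAddCommGroup E]
    {μ : Measure α} {f : ℕ → Lp E 2 μ} {g : Lp E 2 μ} {f' : ℕ → α → E} {g' : α → E}
    (hf : ∀ n, f n =ᵐ[μ] f' n) (hg : g =ᵐ[μ] g') :
    Tendsto f atTop (𝓝 g) ↔ Tendsto (fun n => eLpNorm (fun y => f' n y - g' y) 2 μ) atTop (𝓝 0) := by
  rw [Lp.tendsto_Lp_iff_tendsto_eLpNorm']
  have : ∀ n, eLpNorm (⇑(f n) - ⇑g) 2 μ = eLpNorm (fun y => f' n y - g' y) 2 μ := fun n =>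
    eLpNorm_congr_ae ((hf n).sub hg)
  simp only [this]

/-- The four limits in `HasTrace` are componentwise convergence in `DataSpace` of a tail of smooth
quadruples. With the converse below, traces and the closed subspace are interchangeable. -/
theorem HasTrace.mem_traceData {T : H1 Ω z₁ z₂} {g : Space → ℝ} (h : HasTrace T g)
    {X : DataSpace Ω z₁ z₂} (hX : Represents X T.val T.grad T.dz g) : X ∈ traceData Ω z₁ z₂ := by
  obtain ⟨ψ, hψ, h1, h2, h3, h4⟩ := h.approx
  have hψ1 := fun n => contDiff_one_of_infty (hψ n)
  have e1 := eventually_memLp_of_tendsto (fun n => (hψ n).continuous.aestronglyMeasurable)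
    T.memLp_val h1
  have e2 := eventually_memLp_of_tendsto
    (fun n => (continuous_gradient_slice (hψ1 n)).aestronglyMeasurable) T.memLp_grad h2
  have e3 := eventually_memLp_of_tendsto
    (fun n => (continuous_deriv_slice (hψ1 n)).aestronglyMeasurable) T.memLp_dz h3
  have e4 := eventually_memLp_of_tendsto (fun n => (hψ n).continuous.aestronglyMeasurable)
    h.memLp h4
  obtain ⟨N, hN⟩ := eventually_atTop.1 (e1.and (e2.and (e3.and e4)))
  have hex : ∀ n, ∃ Y : DataSpace Ω z₁ z₂,
      Represents Y (ψ (n + N)) (sliceGrad (ψ (n + N))) (sliceDeriv (ψ (n + N))) (ψ (n + N)) :=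
    fun n => by
      obtain ⟨m1, m2, m3, m4⟩ := hN (n + N) (by lia)
      exact ⟨_, represents_mk m1 m2 m3 m4⟩
  choose Y hY using hex
  refine mem_closure_iff_seq_limit.2 ⟨Y, fun n => ⟨ψ (n + N), hψ _, hY n⟩, ?_⟩
  refine DataSpace.tendsto_iff.2 ⟨?_, ?_, ?_, ?_⟩
  · exact (tendsto_Lp_of_ae_eq (fun n => (hY n).val) hX.val).2 ((tendsto_add_atTop_iff_nat N).2 h1)
  · exact (tendsto_Lp_of_ae_eq (fun n => (hY n).grad) hX.grad).2
      ((tendsto_add_atTop_iff_nat N).2 h2)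
  · exact (tendsto_Lp_of_ae_eq (fun n => (hY n).dz) hX.dz).2 ((tendsto_add_atTop_iff_nat N).2 h3)
  · exact (tendsto_Lp_of_ae_eq (fun n => (hY n).trace) hX.trace).2
      ((tendsto_add_atTop_iff_nat N).2 h4)

theorem hasTrace_of_mem_traceData {T : H1 Ω z₁ z₂} {g : Space → ℝ}
    {X : DataSpace Ω z₁ z₂} (hX : Represents X T.val T.grad T.dz g) (h : X ∈ traceData Ω z₁ z₂) :
    HasTrace T g := by
  obtain ⟨Y, hY, hlim⟩ := mem_closure_iff_seq_limit.1 h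
  choose ψ hψ hψY using hY
  obtain ⟨l1, l2, l3, l4⟩ := DataSpace.tendsto_iff.1 hlim
  refine ⟨(Lp.memLp (traceL X)).ae_eq hX.trace, ψ, hψ, ?_, ?_, ?_, ?_⟩
  · exact (tendsto_Lp_of_ae_eq (fun n => (hψY n).val) hX.val).1 l1
  · exact (tendsto_Lp_of_ae_eq (fun n => (hψY n).grad) hX.grad).1 l2
  · exact (tendsto_Lp_of_ae_eq (fun n => (hψY n).dz) hX.dz).1 l3
  · exact (tendsto_Lp_of_ae_eq (fun n => (hψY n).trace) hX.trace).1 l4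

instance : (volume : Measure Space).IsAddHaarMeasure :=
  inferInstanceAs ((volume : Measure Plane).prod (volume : Measure ℝ)).IsAddHaarMeasure

theorem isWeakDeriv_of_contDiff {U : Set Space} {ψ : Space → ℝ} (hψ : ContDiff ℝ 1 ψ) (e : Space) :
    IsWeakDeriv U ψ (fun y => fderiv ℝ ψ y e) e := by
  intro φ hφ hc hsub
  have hφ1 : ContDiff ℝ 1 φ := contDiff_one_of_infty hφ
  have hdφ : Continuous fun y => fderiv ℝ φ y e :=
    (hφ1.continuous_fderiv one_ne_zero).clm_apply continuous_const
  have hdψ : Continuous fun y => fderiv ℝ ψ y e :=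
    (hψ.continuous_fderiv one_ne_zero).clm_apply continuous_const
  have hcd : HasCompactSupport fun y => fderiv ℝ φ y e := hc.fderiv_apply ℝ e
  rw [setIntegral_eq_integral_of_forall_compl_eq_zero, setIntegral_eq_integral_of_forall_compl_eq_zero]
  · refine integral_mul_fderiv_eq_neg_fderiv_mul_of_integrable ?_ ?_ ?_ ?_ ?_
    · exact (hdψ.mul hφ.continuous).integrable_of_hasCompactSupport hc.mul_left
    · exact (hψ.continuous.mul hdφ).integrable_of_hasCompactSupport hcd.mul_left
    · exact (hψ.continuous.mul hφ.continuous).integrable_of_hasCompactSupport hc.mul_left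
    · exact fun x _ => hψ.differentiable one_ne_zero x
    · exact fun x _ => hφ1.differentiable one_ne_zero x
  · intro y hy
    rw [image_eq_zero_of_notMem_tsupport fun h => hy (hsub h), mul_zero]
  · intro y hy
    have : fderiv ℝ φ y = 0 := by
      by_contra h0
      exact hy (hsub (support_fderiv_subset ℝ h0))
    rw [this]
    simp

/-- Weak derivatives pass to `L²` limits: the defining identity as a closed condition. -/
theorem isClosed_weak_identity {F : Type*} [NormedAddCommGroup F] [InnerProductSpace ℝ F]
    {D : DataSpace Ω z₁ z₂ →L[ℝ] Lp F 2 (volume.restrict (cylinder Ω z₁ z₂))} (f : F) (e : Space)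
    {φ : Space → ℝ} (hφ : ContDiff ℝ ∞ φ) (hc : HasCompactSupport φ) :
    IsClosed {X : DataSpace Ω z₁ z₂ | ∫ y in cylinder Ω z₁ z₂, valL X y * fderiv ℝ φ y e
      = -∫ y in cylinder Ω z₁ z₂, inner ℝ (D X y) f * φ y} := by
  have hφ1 : ContDiff ℝ 1 φ := contDiff_one_of_infty hφ
  have hdφ : Continuous fun y => fderiv ℝ φ y e :=
    (hφ1.continuous_fderiv one_ne_zero).clm_apply continuous_const
  have m1 : MemLp (fun y => fderiv ℝ φ y e) 2 (volume.restrict (cylinder Ω z₁ z₂)) :=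
    (hdφ.memLp_of_hasCompactSupport (hc.fderiv_apply ℝ e)).restrict _
  have m2 : MemLp (fun y => φ y • f) 2 (volume.restrict (cylinder Ω z₁ z₂)) :=
    ((hφ.continuous.smul continuous_const).memLp_of_hasCompactSupport hc.smul_right).restrict _
  have r1 : ∀ X : DataSpace Ω z₁ z₂, ∫ y in cylinder Ω z₁ z₂, valL X y * fderiv ℝ φ y e
      = inner ℝ (valL X) (m1.toLp _) := by
    intro X
    rw [L2.inner_def]
    refine integral_congr_ae ?_
    filter_upwards [m1.coeFn_toLp] with y hy
    rw [hy]
    simp [mul_comm]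
  have r2 : ∀ X : DataSpace Ω z₁ z₂, ∫ y in cylinder Ω z₁ z₂, inner ℝ (D X y) f * φ y
      = inner ℝ (D X) (m2.toLp _) := by
    intro X
    rw [L2.inner_def]
    refine integral_congr_ae ?_
    filter_upwards [m2.coeFn_toLp] with y hy
    rw [hy, real_inner_smul_right, mul_comm]
  simp only [r1, r2]
  exact isClosed_eq (valL.continuous.inner continuous_const) (D.continuous.inner continuous_const).neg

/-- For each fixed test function the identity is a closed condition, and smooth functions satisfy it
by classical integration by parts. -/
theorem isWeakDeriv_gradL {X : DataSpace Ω z₁ z₂} (hX : X ∈ traceData Ω z₁ z₂) (e : Plane) :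
    IsWeakDeriv (cylinder Ω z₁ z₂) (valL X) (fun y => inner ℝ (gradL X y) e) (e, 0) := by
  intro φ hφ hc hsub
  refine traceData_induction (isClosed_weak_identity (D := gradL) e (e, 0) hφ hc) ?_ hX
  intro Y ψ hψ hY
  have hψ1 := contDiff_one_of_infty hψ
  have h := isWeakDeriv_of_contDiff (U := cylinder Ω z₁ z₂) hψ1 (e, 0) φ hφ hc hsub
  have h1 : ∫ y in cylinder Ω z₁ z₂, valL Y y * fderiv ℝ φ y (e, 0)
      = ∫ y in cylinder Ω z₁ z₂, ψ y * fderiv ℝ φ y (e, 0) := by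
    refine integral_congr_ae ?_
    filter_upwards [hY.val] with y hy
    rw [hy]
  rw [h1, h]
  congr 1
  refine integral_congr_ae ?_
  filter_upwards [hY.grad] with y hy
  rw [hy, inner_sliceGrad hψ1]

theorem isWeakDeriv_dzL {X : DataSpace Ω z₁ z₂} (hX : X ∈ traceData Ω z₁ z₂) :
    IsWeakDeriv (cylinder Ω z₁ z₂) (valL X) (dzL X) (0, 1) := by
  intro φ hφ hc hsub
  suffices h : ∫ y in cylinder Ω z₁ z₂, valL X y * fderiv ℝ φ y (0, 1)
      = -∫ y in cylinder Ω z₁ z₂, inner ℝ (dzL X y) 1 * φ y by simpa using h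
  refine traceData_induction (isClosed_weak_identity (D := dzL) 1 (0, 1) hφ hc) ?_ hX
  intro Y ψ hψ hY
  have hψ1 := contDiff_one_of_infty hψ
  have h := isWeakDeriv_of_contDiff (U := cylinder Ω z₁ z₂) hψ1 (0, 1) φ hφ hc hsub
  have h1 : ∫ y in cylinder Ω z₁ z₂, valL Y y * fderiv ℝ φ y (0, 1)
      = ∫ y in cylinder Ω z₁ z₂, ψ y * fderiv ℝ φ y (0, 1) := by
    refine integral_congr_ae ?_
    filter_upwards [hY.val] with y hy
    rw [hy]
  rw [h1, h]
  congr 1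
  refine integral_congr_ae ?_
  filter_upwards [hY.dz] with y hy
  rw [hy, sliceDeriv_apply hψ1]
  simp

/-- The `H¹` function underlying a quadruple. -/
noncomputable def H1.ofData {X : DataSpace Ω z₁ z₂} (hX : X ∈ traceData Ω z₁ z₂) : H1 Ω z₁ z₂ where
  val := valL X
  grad := gradL X
  dz := dzL X
  memLp_val := Lp.memLp _
  memLp_grad := Lp.memLp _
  memLp_dz := Lp.memLp _
  weak_grad := isWeakDeriv_gradL hX
  weak_dz := isWeakDeriv_dzL hX

theorem hasTrace_ofData {X : DataSpace Ω z₁ z₂} (hX : X ∈ traceData Ω z₁ z₂) :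
    HasTrace (H1.ofData hX) (traceL X) :=
  hasTrace_of_mem_traceData (represents_self X) hX

theorem HasTrace.exists_data {T : H1 Ω z₁ z₂} {g : Space → ℝ} (h : HasTrace T g) :
    ∃ X ∈ traceData Ω z₁ z₂, Represents X T.val T.grad T.dz g :=
  ⟨_, h.mem_traceData (represents_mk T.memLp_val T.memLp_grad T.memLp_dz h.memLp),
    represents_mk T.memLp_val T.memLp_grad T.memLp_dz h.memLp⟩

/-! ### Essential boundary conditions and the closed test space -/

section Essential

variable (Γ : LateralPartition Ω)

theorem LateralPartition.ΓR_subset : Γ.ΓR ⊆ frontier Ω := by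
  rw [← Γ.cover]
  exact fun x hx => Or.inl (Or.inr hx)

theorem LateralPartition.Γper_subset : Γ.Γper ⊆ frontier Ω := by
  rw [← Γ.cover]
  exact subset_union_right

theorem LateralPartition.side_subset (j : Fin Γ.numPairs) : Γ.side j ⊆ frontier Ω := by
  refine Subset.trans (fun x hx => ?_) Γ.Γper_subset
  rw [Γ.Γper_eq]
  exact mem_iUnion.2 ⟨j, Or.inl hx⟩

theorem LateralPartition.shift_side_subset (j : Fin Γ.numPairs) :
    (fun x => x + Γ.shift j) '' Γ.side j ⊆ frontier Ω := by
  refine Subset.trans (fun x hx => ?_) Γ.Γper_subset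
  rw [Γ.Γper_eq]
  exact mem_iUnion.2 ⟨j, Or.inr hx⟩

variable {Γ}

theorem IsLipschitzDomain.ae_shift (hΩ : IsLipschitzDomain Ω) {p : Space → Prop}
    (h : ∀ᵐ y ∂boundaryMeasure Ω z₁ z₂, p y) (j : Fin Γ.numPairs) :
    ∀ᵐ y ∂(boundaryMeasure Ω z₁ z₂).restrict (Γ.side j ×ˢ Ioo z₁ z₂),
      p (y.1 + Γ.shift j, y.2) :=
  (hΩ.quasiMeasurePreserving_shift (Γ.side_subset j) (Γ.shift_side_subset j)).ae h

theorem LateralEssential.congr (hΩ : IsLipschitzDomain Ω) {g g' : Space → ℝ}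
    (h : LateralEssential Γ z₁ z₂ g) (hg : g =ᵐ[boundaryMeasure Ω z₁ z₂] g') :
    LateralEssential Γ z₁ z₂ g' := by
  refine ⟨?_, fun j => ?_⟩
  · filter_upwards [h.1, ae_restrict_of_ae hg] with y h1 h2
    rw [← h2, h1]
  · filter_upwards [h.2 j, ae_restrict_of_ae hg, hΩ.ae_shift hg j] with y h1 h2 h3
    rw [← h2, ← h3, h1]

theorem LateralEssential.add {g g' : Space → ℝ} (h : LateralEssential Γ z₁ z₂ g)
    (h' : LateralEssential Γ z₁ z₂ g') : LateralEssential Γ z₁ z₂ (g + g') := by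
  refine ⟨?_, fun j => ?_⟩
  · filter_upwards [h.1, h'.1] with y h1 h2
    simp [h1, h2]
  · filter_upwards [h.2 j, h'.2 j] with y h1 h2
    simp [h1, h2]

theorem LateralEssential.smul {g : Space → ℝ} (h : LateralEssential Γ z₁ z₂ g) (c : ℝ) :
    LateralEssential Γ z₁ z₂ (c • g) := by
  refine ⟨?_, fun j => ?_⟩
  · filter_upwards [h.1] with y h1
    simp [h1]
  · filter_upwards [h.2 j] with y h1
    simp [h1]

/-- Periodicity compares two boundary points, so convergence is needed almost everywhere at `y` and
also at its translate, which `ae_shift` supplies. -/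
theorem LateralEssential.of_tendsto (hΩ : IsLipschitzDomain Ω) {g : ℕ → Space → ℝ}
    {g' : Space → ℝ} (h : ∀ n, LateralEssential Γ z₁ z₂ (g n))
    (hlim : ∀ᵐ y ∂boundaryMeasure Ω z₁ z₂, Tendsto (fun n => g n y) atTop (𝓝 (g' y))) :
    LateralEssential Γ z₁ z₂ g' := by
  refine ⟨?_, fun j => ?_⟩
  · filter_upwards [ae_all_iff.2 fun n => (h n).1, ae_restrict_of_ae hlim] with y h1 h2
    simp only [h1] at h2
    exact tendsto_nhds_unique h2 tendsto_const_nhds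
  · filter_upwards [ae_all_iff.2 fun n => (h n).2 j, ae_restrict_of_ae hlim,
      hΩ.ae_shift hlim j] with y h1 h2 h3
    simp only [h1] at h3
    exact tendsto_nhds_unique h3 h2

theorem InAffineSpace.congr (hΩ : IsLipschitzDomain Ω) {ΩD : Set Space} {g g' TD : Space → ℝ}
    (h : LateralEssential Γ z₁ z₂ g ∧ ∀ᵐ y ∂(boundaryMeasure Ω z₁ z₂).restrict ΩD, g y = TD y)
    (hg : g =ᵐ[boundaryMeasure Ω z₁ z₂] g') :
    LateralEssential Γ z₁ z₂ g' ∧ ∀ᵐ y ∂(boundaryMeasure Ω z₁ z₂).restrict ΩD, g' y = TD y := by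
  refine ⟨h.1.congr hΩ hg, ?_⟩
  filter_upwards [h.2, ae_restrict_of_ae hg] with y h1 h2
  rw [← h2, h1]

/-- The quadruples of test functions. -/
noncomputable def testData (hΩ : IsLipschitzDomain Ω) (z₁ z₂ : ℝ) (Γ : LateralPartition Ω)
    (ΩD : Set Space) : Submodule ℝ (DataSpace Ω z₁ z₂) where
  carrier := {X | X ∈ traceData Ω z₁ z₂ ∧ LateralEssential Γ z₁ z₂ (traceL X) ∧
    ∀ᵐ y ∂(boundaryMeasure Ω z₁ z₂).restrict ΩD, traceL X y = (0 : Space → ℝ) y}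
  add_mem' := by
    rintro X Y ⟨h1, h2⟩ ⟨h1', h2'⟩
    refine ⟨add_mem h1 h1', InAffineSpace.congr hΩ (g := traceL X + traceL Y)
      ⟨h2.1.add h2'.1, ?_⟩ ?_⟩
    · filter_upwards [h2.2, h2'.2] with y e1 e2
      simp [e1, e2]
    · rw [map_add]
      exact (Lp.coeFn_add _ _).symm
  zero_mem' := by
    refine ⟨zero_mem _, InAffineSpace.congr hΩ (g := 0) ⟨⟨?_, fun j => ?_⟩, ?_⟩ ?_⟩
    · exact Eventually.of_forall fun y => rfl
    · exact Eventually.of_forall fun y => rfl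
    · exact Eventually.of_forall fun y => rfl
    · rw [map_zero]
      exact (Lp.coeFn_zero _ _ _).symm
  smul_mem' := by
    rintro c X ⟨h1, h2⟩
    refine ⟨Submodule.smul_mem _ c h1, InAffineSpace.congr hΩ (g := c • ⇑(traceL X))
      ⟨h2.1.smul c, ?_⟩ ?_⟩
    · filter_upwards [h2.2] with y e1
      simp [e1]
    · rw [map_smul]
      exact (Lp.coeFn_smul _ _).symm

/-- `L²` convergence of traces gives almost everywhere convergence along a subsequence, which
preserves the pointwise conditions. -/
theorem isClosed_testData (hΩ : IsLipschitzDomain Ω) (Γ : LateralPartition Ω) (ΩD : Set Space) :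
    IsClosed (testData hΩ z₁ z₂ Γ ΩD : Set (DataSpace Ω z₁ z₂)) := by
  refine IsSeqClosed.isClosed fun X Y hX hlim => ?_
  have h1 : Y ∈ traceData Ω z₁ z₂ := isClosed_traceData.mem_of_tendsto hlim
    (Eventually.of_forall fun n => (hX n).1)
  obtain ⟨ns, -, hns⟩ := (tendstoInMeasure_of_tendsto_Lp
    (DataSpace.tendsto_iff.1 hlim).2.2.2).exists_seq_tendsto_ae
  refine ⟨h1, LateralEssential.of_tendsto hΩ (fun n => (hX (ns n)).2.1) hns, ?_⟩
  filter_upwards [ae_all_iff.2 fun n => (hX (ns n)).2.2, ae_restrict_of_ae hns] with y e1 e2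
  simp only [e1] at e2
  exact tendsto_nhds_unique e2 tendsto_const_nhds

end Essential

/-! ### Integration by parts in the convection term -/

section Convection

theorem continuous_weightedInner {α E V : Type*} [MeasurableSpace α] {μ : Measure α}
    [NormedAddCommGroup E] [InnerProductSpace ℝ E] [NormedAddCommGroup V] [NormedSpace ℝ V]
    {f : α → ℝ} (hf : MemLp f ⊤ μ) (P Q : V →L[ℝ] Lp E 2 μ) :
    Continuous fun X => weightedInner f hf (P X) (Q X) :=
  ((weightedInner f hf).continuous.comp P.continuous).clm_apply Q.continuous

theorem integral_deriv_mul_self {f : ℝ → ℝ} (hf : ContDiff ℝ 1 f) (hz : z₁ ≤ z₂) :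
    ∫ z in Ioo z₁ z₂, deriv f z * f z = (1 / 2) * (f z₂ * f z₂ - f z₁ * f z₁) := by
  have hd : Continuous (deriv f) := hf.continuous_deriv le_rfl
  have h1 : ∀ z, HasDerivAt (fun z => (1 / 2) * (f z * f z)) (deriv f z * f z) z := by
    intro z
    have h := (hf.differentiable one_ne_zero z).hasDerivAt
    exact ((h.mul h).const_mul (1 / 2 : ℝ)).congr_deriv (by ring)
  rw [← integral_Ioc_eq_integral_Ioo, ← intervalIntegral.integral_of_le hz,
    intervalIntegral.integral_eq_sub_of_hasDerivAt (fun z _ => h1 z)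
      ((hd.mul hf.continuous).intervalIntegrable _ _)]
  ring

theorem integral_prod_dirac {μ : Measure Plane} [SFinite μ] (f : Space → ℝ) (z : ℝ)
    (hf : AEStronglyMeasurable f (μ.prod (Measure.dirac z))) :
    ∫ y, f y ∂(μ.prod (Measure.dirac z)) = ∫ x, f (x, z) ∂μ := by
  rw [Measure.prod_dirac] at hf ⊢
  exact integral_map (by fun_prop) hf

theorem integrable_prod_dirac {μ : Measure Plane} [SFinite μ] {f : Space → ℝ} {z : ℝ}
    (hf : Integrable f (μ.prod (Measure.dirac z))) : Integrable (fun x => f (x, z)) μ := by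
  rw [Measure.prod_dirac] at hf
  exact hf.comp_measurable (by fun_prop)

theorem weightedInner_indicator {X : DataSpace Ω z₁ z₂} {ψ f : Space → ℝ} {A : Set Space}
    (hA : MeasurableSet A) (hf : MemLp (A.indicator f) ⊤ (boundaryMeasure Ω z₁ z₂))
    (hX : traceL X =ᵐ[boundaryMeasure Ω z₁ z₂] ψ) :
    weightedInner _ hf (traceL X) (traceL X)
        = ∫ y in A, f y * (ψ y * ψ y) ∂boundaryMeasure Ω z₁ z₂ ∧
      IntegrableOn (fun y => f y * (ψ y * ψ y)) A (boundaryMeasure Ω z₁ z₂) := by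
  have hae : (fun y => A.indicator f y * inner ℝ (traceL X y) (traceL X y))
      =ᵐ[boundaryMeasure Ω z₁ z₂] A.indicator fun y => f y * (ψ y * ψ y) := by
    filter_upwards [hX] with y hy
    by_cases hyA : y ∈ A <;> simp [hyA, hy, sq]
  refine ⟨?_, ?_⟩
  · rw [weightedInner_apply, integral_congr_ae hae, integral_indicator hA]
  · rw [← integrable_indicator_iff hA]
    exact (integrable_weighted hf (traceL X) (traceL X)).congr hae

/-- Integration by parts in the convection term. -/
theorem IsLipschitzDomain.convection_eq (hΩ : IsLipschitzDomain Ω) (hz : z₁ < z₂) {h : Plane → ℝ}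
    (hh : MemLp h ⊤ (volume.restrict Ω)) {X : DataSpace Ω z₁ z₂} (hX : X ∈ traceData Ω z₁ z₂) :
    weightedInner _ (memLp_top_cylinder hh) (dzL X) (valL X) =
      (1 / 2) * (weightedInner _ (hΩ.memLp_top_outlet hz hh) (traceL X) (traceL X)
        - weightedInner _ (hΩ.memLp_top_inlet hz hh) (traceL X) (traceL X)) := by
  have := hΩ.isFiniteMeasure_volume
  refine traceData_induction (p := fun X => weightedInner _ (memLp_top_cylinder hh) (dzL X) (valL X)
    = (1 / 2) * (weightedInner _ (hΩ.memLp_top_outlet hz hh) (traceL X) (traceL X)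
        - weightedInner _ (hΩ.memLp_top_inlet hz hh) (traceL X) (traceL X))) ?_ ?_ hX
  · exact isClosed_eq (continuous_weightedInner _ dzL valL) (continuous_const.mul
      ((continuous_weightedInner _ traceL traceL).sub (continuous_weightedInner _ traceL traceL)))
  intro Y ψ hψ hY
  have hψ1 := contDiff_one_of_infty hψ
  obtain ⟨o1, o2⟩ := weightedInner_indicator
    (hΩ.isOpen.measurableSet.prod (measurableSet_singleton z₂)) (hΩ.memLp_top_outlet hz hh) hY.trace
  obtain ⟨i1, i2⟩ := weightedInner_indicator
    (hΩ.isOpen.measurableSet.prod (measurableSet_singleton z₁)) (hΩ.memLp_top_inlet hz hh) hY.trace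
  rw [IntegrableOn, hΩ.boundaryMeasure_restrict_outlet hz] at o2
  rw [IntegrableOn, hΩ.boundaryMeasure_restrict_inlet hz] at i2
  rw [hΩ.boundaryMeasure_restrict_outlet hz, integral_prod_dirac _ _ o2.1] at o1
  rw [hΩ.boundaryMeasure_restrict_inlet hz, integral_prod_dirac _ _ i2.1] at i1
  have hae : (fun y => h y.1 * inner ℝ (dzL Y y) (valL Y y))
      =ᵐ[volume.restrict (cylinder Ω z₁ z₂)] fun y => h y.1 * (sliceDeriv ψ y * ψ y) := by
    filter_upwards [hY.dz, hY.val] with y e1 e2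
    rw [e1, e2]
    simp [mul_comm]
  have hint := (integrable_weighted (memLp_top_cylinder hh) (dzL Y) (valL Y)).congr hae
  rw [o1, i1, ← integral_sub (integrable_prod_dirac o2) (integrable_prod_dirac i2),
    ← integral_const_mul, weightedInner_apply, integral_congr_ae hae]
  rw [volume_restrict_cylinder] at hint ⊢
  rw [integral_prod _ hint]
  refine integral_congr_ae (Eventually.of_forall fun x => ?_)
  simp only [sliceDeriv]
  -- The factor `h` leaves the axial integral because it depends on `x` alone; what is left is the
  -- integral of the derivative of `ψ² / 2`.
  rw [integral_const_mul, integral_deriv_mul_self (contDiff_slice_right hψ1 x) hz.le]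
  ring

end Convection

/-! ### The weighted Friedrichs inequality -/

/-- The Friedrichs inequality on the cylinder, with a boundary weight. -/
theorem IsLipschitzDomain.cylinder_friedrichs (hΩ : IsLipschitzDomain Ω) (hz : z₁ < z₂)
    {b : Space → ℝ} (hb : MemLp b ⊤ (boundaryMeasure Ω z₁ z₂))
    (hb0 : ∀ᵐ y ∂boundaryMeasure Ω z₁ z₂, 0 ≤ b y) (hb1 : ¬ b =ᵐ[boundaryMeasure Ω z₁ z₂] 0) :
    ∃ C : ℝ, 0 ≤ C ∧ ∀ X ∈ traceData Ω z₁ z₂, ‖valL X‖ ^ 2 + ‖traceL X‖ ^ 2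
      ≤ C * (‖gradL X‖ ^ 2 + ‖dzL X‖ ^ 2 + weightedInner b hb (traceL X) (traceL X)) := by
  have := hΩ.isFiniteMeasure_boundaryMeasure (z₁ := z₁) (z₂ := z₂)
  have := hΩ.isFiniteMeasure_cylinder (z₁ := z₁) (z₂ := z₂)
  set S := boundaryMeasure Ω z₁ z₂ with hS
  -- The weight becomes the reference measure of the abstract Friedrichs inequality. Since `b` is
  -- bounded, this measure is at most a multiple of the surface measure and inherits its control.
  set νb := S.withDensity fun y => ENNReal.ofReal (b y) with hνb
  have hbm : AEMeasurable (fun y => ENNReal.ofReal (b y)) S :=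
    hb.1.aemeasurable.ennreal_ofReal
  have hle : νb ≤ (((eLpNorm b ⊤ S).toNNReal : ℝ≥0) : ℝ≥0∞) • S := by
    rw [← withDensity_const, ENNReal.coe_toNNReal hb.2.ne]
    refine withDensity_mono ?_
    rw [eLpNorm_exponent_top]
    filter_upwards [ae_le_eLpNormEssSup (f := b) (μ := S)] with y hy
    refine le_trans ?_ hy
    rw [← ofReal_norm]
    exact ENNReal.ofReal_le_ofReal (le_abs_self _)
  have hν0 : νb ≠ 0 := by
    intro h0
    rw [hνb, withDensity_eq_zero_iff hbm] at h0
    refine hb1 ?_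
    filter_upwards [h0, hb0] with y e1 e2
    exact le_antisymm (ENNReal.ofReal_eq_zero.1 e1) e2
  have hfin : IsFiniteMeasure νb := by
    have : IsFiniteMeasure ((((eLpNorm b ⊤ S).toNNReal : ℝ≥0) : ℝ≥0∞) • S) :=
      Measure.smul_finite S (by simp)
    exact isFiniteMeasure_of_le _ hle
  have hctl := (((hΩ.cylinder_poincare hz).mono le_rfl
    (Measure.le_add_left le_rfl)).smul_right (eLpNorm b ⊤ S).toNNReal).mono le_rfl hle
  obtain ⟨C, hC⟩ := hctl.friedrichs SpaceFun.measurable hν0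
  refine ⟨C, C.coe_nonneg, fun X hX => ?_⟩
  refine traceData_induction (p := fun X => ‖valL X‖ ^ 2 + ‖traceL X‖ ^ 2
      ≤ C * (‖gradL X‖ ^ 2 + ‖dzL X‖ ^ 2 + weightedInner b hb (traceL X) (traceL X))) ?_ ?_ hX
  · exact isClosed_le (by fun_prop) (by fun_prop)
  intro Y ψ hψ hY
  have hψ1 := contDiff_one_of_infty hψ
  have key := hC ⟨ψ, hψ1⟩
  have hw : 0 ≤ weightedInner b hb (traceL Y) (traceL Y) :=
    weightedInner_self_nonneg hb (hb0.mono fun y hy => Or.inr hy)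
  have hpow : ∀ {E : Type} [NormedAddCommGroup E] (x : E), ENNReal.ofReal (‖x‖ ^ 2) = ‖x‖ₑ ^ 2 :=
    fun x => by rw [ENNReal.ofReal_pow (norm_nonneg _), ofReal_norm]
  rw [← ENNReal.ofReal_le_ofReal_iff (by positivity), ENNReal.ofReal_mul C.coe_nonneg,
    ENNReal.ofReal_add (by positivity) (by positivity), ENNReal.ofReal_add (by positivity) hw,
    ENNReal.ofReal_add (by positivity) (by positivity), hpow, hpow, hpow, hpow,
    ofReal_weightedInner_self hb hb0, enorm_sq_eq_lintegral, enorm_sq_eq_lintegral,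
    enorm_sq_eq_lintegral, enorm_sq_eq_lintegral, ENNReal.ofReal_coe_nnreal]
  rw [lintegral_add_measure, cylinderEnergy,
    lintegral_withDensity_eq_lintegral_mul₀ hbm
      (hψ.continuous.measurable.enorm.pow_const 2).aemeasurable] at key
  convert key using 1
  · congr 1
    · exact lintegral_congr_ae (hY.val.mono fun y hy => by simp only [hy])
    · exact lintegral_congr_ae (hY.trace.mono fun y hy => by simp only [hy])
  · congr 1
    congr 1
    · congr 1
      · exact lintegral_congr_ae (hY.grad.mono fun y hy => by simp only [hy, sliceGrad])
      · exact lintegral_congr_ae (hY.dz.mono fun y hy => by simp only [hy, sliceDeriv])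
    · exact lintegral_congr_ae (hY.trace.mono fun y hy => by simp only [hy, Pi.mul_apply])

/-! ### The variational form, the loads and coercivity -/

variable {Γ : LateralPartition Ω} {c σ h a : Plane → ℝ}

theorem IsDiffusionCoefficient.memLp_top {f : Plane → ℝ} (hf : IsDiffusionCoefficient Ω f) :
    MemLp f ⊤ (volume.restrict Ω) := by
  obtain ⟨hm, m, M, hm0, hb⟩ := hf
  refine memLp_top_of_bound hm M ?_
  filter_upwards [hb] with x hx
  rw [Real.norm_eq_abs, abs_of_nonneg (hm0.le.trans hx.1)]
  exact hx.2

/-- The variational form on quadruples. -/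
noncomputable def formL (hΩ : IsLipschitzDomain Ω) (z₁ z₂ : ℝ) (Γ : LateralPartition Ω)
    (hc : MemLp c ⊤ (volume.restrict Ω)) (hσ : MemLp σ ⊤ (volume.restrict Ω))
    (hh : MemLp h ⊤ (volume.restrict Ω))
    (ha : MemLp a ⊤ ((Measure.hausdorffMeasure 1).restrict Γ.ΓR)) :
    DataSpace Ω z₁ z₂ →L[ℝ] DataSpace Ω z₁ z₂ →L[ℝ] ℝ :=
  (weightedInner _ (memLp_top_cylinder hc)).bilinearComp dzL dzL
    + (weightedInner _ (memLp_top_cylinder hσ)).bilinearComp gradL gradL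
    + (weightedInner _ (memLp_top_cylinder hh)).bilinearComp dzL valL
    + (weightedInner _ (hΩ.memLp_top_lateral Γ.ΓR_subset Γ.measurableSet_ΓR ha)).bilinearComp
        traceL traceL

section

variable (hΩ : IsLipschitzDomain Ω)
    (hc : MemLp c ⊤ (volume.restrict Ω)) (hσ : MemLp σ ⊤ (volume.restrict Ω))
    (hh : MemLp h ⊤ (volume.restrict Ω))
    (ha : MemLp a ⊤ ((Measure.hausdorffMeasure 1).restrict Γ.ΓR))

theorem formL_apply (X Y : DataSpace Ω z₁ z₂) : formL hΩ z₁ z₂ Γ hc hσ hh ha X Y =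
    weightedInner _ (memLp_top_cylinder hc) (dzL X) (dzL Y)
      + weightedInner _ (memLp_top_cylinder hσ) (gradL X) (gradL Y)
      + weightedInner _ (memLp_top_cylinder hh) (dzL X) (valL Y)
      + weightedInner _ (hΩ.memLp_top_lateral Γ.ΓR_subset Γ.measurableSet_ΓR ha)
          (traceL X) (traceL Y) := rfl

theorem form_eq_formL {T φ : H1 Ω z₁ z₂} {g k : Space → ℝ} {X Y : DataSpace Ω z₁ z₂}
    (hX : Represents X T.val T.grad T.dz g) (hY : Represents Y φ.val φ.grad φ.dz k) :
    form Γ c σ h a T g φ k = formL hΩ z₁ z₂ Γ hc hσ hh ha X Y := by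
  rw [formL_apply, form]
  congr 1
  · have i₁ := integrable_weighted (memLp_top_cylinder hc) (dzL X) (dzL Y)
    have i₂ := integrable_weighted (memLp_top_cylinder hσ) (gradL X) (gradL Y)
    have i₃ := integrable_weighted (memLp_top_cylinder hh) (dzL X) (valL Y)
    rw [weightedInner_apply, weightedInner_apply, weightedInner_apply, ← integral_add i₁ i₂,
      ← integral_add (i₁.fun_add i₂) i₃]
    refine integral_congr_ae ?_
    filter_upwards [hX.dz, hX.grad, hY.dz, hY.grad, hY.val] with y e1 e2 e3 e4 e5
    rw [e1, e2, e3, e4, e5]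
    simp only [RCLike.inner_apply, conj_trivial]
    ring
  · rw [weightedInner_apply, ← integral_indicator (Γ.measurableSet_ΓR.prod measurableSet_Ioo)]
    refine integral_congr_ae ?_
    filter_upwards [hX.trace, hY.trace] with y e1 e2
    rw [e1, e2]
    by_cases hy : y ∈ Γ.ΓR ×ˢ Ioo z₁ z₂
    · rw [indicator_of_mem hy, indicator_of_mem hy]
      simp only [RCLike.inner_apply, conj_trivial]
      ring
    · rw [indicator_of_notMem hy, indicator_of_notMem hy, zero_mul]

theorem exists_load {A : Set Space} (hA : MeasurableSet A) {f : Space → ℝ}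
    (hf : MemLp f 2 ((boundaryMeasure Ω z₁ z₂).restrict A)) :
    ∃ l : DataSpace Ω z₁ z₂ →L[ℝ] ℝ, ∀ (Y : DataSpace Ω z₁ z₂) (k : Space → ℝ),
      traceL Y =ᵐ[boundaryMeasure Ω z₁ z₂] k →
        l Y = ∫ y in A, f y * k y ∂boundaryMeasure Ω z₁ z₂ := by
  have hm : MemLp (A.indicator f) 2 (boundaryMeasure Ω z₁ z₂) := (memLp_indicator_iff_restrict hA).2 hf
  refine ⟨(innerSL ℝ (hm.toLp _)).comp traceL, fun Y k hk => ?_⟩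
  change inner ℝ (hm.toLp _) (traceL Y) = _
  rw [L2.inner_def, ← integral_indicator hA]
  refine integral_congr_ae ?_
  filter_upwards [hk, hm.coeFn_toLp] with y e1 e2
  rw [e1, e2]
  by_cases hy : y ∈ A <;> simp [hy, mul_comm]

theorem memLp_two_load {A B : Set Space} {f g : Space → ℝ}
    (hf : MemLp (B.indicator f) ⊤ (boundaryMeasure Ω z₁ z₂)) (hB : MeasurableSet B)
    (hg : MemLp g 2 ((boundaryMeasure Ω z₁ z₂).restrict A)) :
    MemLp (fun y => f y * g y) 2 ((boundaryMeasure Ω z₁ z₂).restrict (A ∩ B)) := by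
  have h1 : MemLp f ⊤ ((boundaryMeasure Ω z₁ z₂).restrict (A ∩ B)) :=
    ((memLp_indicator_iff_restrict hB).1 hf).mono_measure
      (Measure.restrict_mono inter_subset_right le_rfl)
  have h2 : MemLp g 2 ((boundaryMeasure Ω z₁ z₂).restrict (A ∩ B)) :=
    hg.mono_measure (Measure.restrict_mono inter_subset_left le_rfl)
  exact h2.mul' h1

/-- By `convection_eq` only the ends matter. At `z₂` the trace vanishes where `h < 0`, so the outlet
term is nonnegative; at `z₁` it vanishes where `h > 0`, so the subtracted inlet term is nonpositive.
-/
theorem convection_nonneg (hz : z₁ < z₂) {ΩD : Set Space} (hΩD : MeasurableSet ΩD)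
    (hin₁ : ∀ᵐ x ∂volume.restrict Ω, 0 < h x → (x, z₁) ∈ ΩD)
    (hin₂ : ∀ᵐ x ∂volume.restrict Ω, h x < 0 → (x, z₂) ∈ ΩD)
    {X : DataSpace Ω z₁ z₂} (hX : X ∈ testData hΩ z₁ z₂ Γ ΩD) :
    0 ≤ weightedInner _ (memLp_top_cylinder hh) (dzL X) (valL X) := by
  have := hΩ.isFiniteMeasure_volume
  have mo : MeasurableSet (Ω ×ˢ {z₂}) := hΩ.isOpen.measurableSet.prod (measurableSet_singleton z₂)
  have mi : MeasurableSet (Ω ×ˢ {z₁}) := hΩ.isOpen.measurableSet.prod (measurableSet_singleton z₁)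
  have hD := (ae_restrict_iff' hΩD).1 hX.2.2
  have ho : ∀ᵐ y ∂boundaryMeasure Ω z₁ z₂, y ∈ Ω ×ˢ {z₂} → (h y.1 < 0 → (y.1, z₂) ∈ ΩD) := by
    rw [← ae_restrict_iff' mo, hΩ.boundaryMeasure_restrict_outlet hz]
    exact Measure.quasiMeasurePreserving_fst.ae hin₂
  have hi : ∀ᵐ y ∂boundaryMeasure Ω z₁ z₂, y ∈ Ω ×ˢ {z₁} → (0 < h y.1 → (y.1, z₁) ∈ ΩD) := by
    rw [← ae_restrict_iff' mi, hΩ.boundaryMeasure_restrict_inlet hz]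
    exact Measure.quasiMeasurePreserving_fst.ae hin₁
  have no : 0 ≤ weightedInner _ (hΩ.memLp_top_outlet hz hh) (traceL X) (traceL X) := by
    refine weightedInner_self_nonneg _ ?_
    filter_upwards [hD, ho] with y e1 e2
    by_cases hy : y ∈ Ω ×ˢ {z₂}
    · by_cases hneg : h y.1 < 0
      · have h3 := e2 hy hneg
        have h4 : y.2 = z₂ := hy.2
        rw [← h4] at h3
        exact Or.inl (e1 h3)
      · rw [indicator_of_mem hy]
        exact Or.inr (not_lt.1 hneg)
    · rw [indicator_of_notMem hy]
      exact Or.inr le_rfl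
  have ni : weightedInner _ (hΩ.memLp_top_inlet hz hh) (traceL X) (traceL X) ≤ 0 := by
    refine weightedInner_self_nonpos _ ?_
    filter_upwards [hD, hi] with y e1 e2
    by_cases hy : y ∈ Ω ×ˢ {z₁}
    · by_cases hpos : 0 < h y.1
      · have h3 := e2 hy hpos
        have h4 : y.2 = z₁ := hy.2
        rw [← h4] at h3
        exact Or.inl (e1 h3)
      · rw [indicator_of_mem hy]
        exact Or.inr (not_lt.1 hpos)
    · rw [indicator_of_notMem hy]
      exact Or.inr le_rfl
  rw [hΩ.convection_eq hz hh hX.1]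
  linarith

theorem ae_lateral_pos (hΩ : IsLipschitzDomain Ω)
    (ha_pos : ∀ᵐ x ∂(Measure.hausdorffMeasure 1).restrict Γ.ΓR, 0 < a x) :
    ∀ᵐ y ∂boundaryMeasure Ω z₁ z₂, y ∈ Γ.ΓR ×ˢ Ioo z₁ z₂ → 0 < a y.1 := by
  rw [← ae_restrict_iff' (Γ.measurableSet_ΓR.prod measurableSet_Ioo),
    hΩ.boundaryMeasure_restrict_lateral Γ.ΓR_subset]
  exact Measure.quasiMeasurePreserving_fst.ae ha_pos

theorem ae_robin_nonneg (hΩ : IsLipschitzDomain Ω)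
    (ha_pos : ∀ᵐ x ∂(Measure.hausdorffMeasure 1).restrict Γ.ΓR, 0 < a x) :
    ∀ᵐ y ∂boundaryMeasure Ω z₁ z₂, 0 ≤ (Γ.ΓR ×ˢ Ioo z₁ z₂).indicator (fun y => a y.1) y := by
  filter_upwards [ae_lateral_pos hΩ ha_pos] with y hy
  exact indicator_apply_nonneg fun h' => (hy h').le

/-- The weight of the boundary terms that control the constants. -/
noncomputable def controlWeight (Γ : LateralPartition Ω) (z₁ z₂ : ℝ) (ΩD : Set Space)
    (a : Plane → ℝ) : Space → ℝ :=
  (ΩD ∪ Γ.ΓD ×ˢ Ioo z₁ z₂).indicator (fun _ => 1)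
    + (Γ.ΓR ×ˢ Ioo z₁ z₂).indicator (fun y => a y.1)

theorem memLp_controlWeight (hΩ : IsLipschitzDomain Ω)
    (ha : MemLp a ⊤ ((Measure.hausdorffMeasure 1).restrict Γ.ΓR)) {ΩD : Set Space}
    (hΩD : MeasurableSet ΩD) :
    MemLp (controlWeight Γ z₁ z₂ ΩD a) ⊤ (boundaryMeasure Ω z₁ z₂) := by
  have h1 : MemLp ((ΩD ∪ Γ.ΓD ×ˢ Ioo z₁ z₂).indicator fun _ => (1 : ℝ)) ⊤
      (boundaryMeasure Ω z₁ z₂) :=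
    MemLp.indicator (hΩD.union (Γ.measurableSet_ΓD.prod measurableSet_Ioo)) (memLp_top_const 1)
  exact h1.add (hΩ.memLp_top_lateral Γ.ΓR_subset Γ.measurableSet_ΓR ha)

theorem ae_controlWeight_nonneg (hΩ : IsLipschitzDomain Ω) (ΩD : Set Space)
    (ha_pos : ∀ᵐ x ∂(Measure.hausdorffMeasure 1).restrict Γ.ΓR, 0 < a x) :
    ∀ᵐ y ∂boundaryMeasure Ω z₁ z₂, 0 ≤ controlWeight Γ z₁ z₂ ΩD a y := by
  filter_upwards [ae_robin_nonneg hΩ ha_pos] with y hy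
  exact add_nonneg (indicator_apply_nonneg fun _ => zero_le_one) hy

theorem controlWeight_not_ae_zero (hΩ : IsLipschitzDomain Ω) {ΩD : Set Space}
    (ha_pos : ∀ᵐ x ∂(Measure.hausdorffMeasure 1).restrict Γ.ΓR, 0 < a x)
    (hcontrol : boundaryMeasure Ω z₁ z₂ (ΩD ∪ (Γ.ΓD ∪ Γ.ΓR) ×ˢ Ioo z₁ z₂) ≠ 0) :
    ¬ controlWeight Γ z₁ z₂ ΩD a =ᵐ[boundaryMeasure Ω z₁ z₂] 0 := by
  refine fun h0 => hcontrol ?_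
  rw [measure_eq_zero_iff_ae_notMem]
  filter_upwards [h0, ae_robin_nonneg hΩ ha_pos, ae_lateral_pos hΩ ha_pos] with y e0 e1 e2 hy
  rw [controlWeight, Pi.add_apply, Pi.zero_apply] at e0
  have e4 : 0 ≤ (ΩD ∪ Γ.ΓD ×ˢ Ioo z₁ z₂).indicator (fun _ => (1 : ℝ)) y :=
    indicator_apply_nonneg fun _ => zero_le_one
  have e5 : y ∉ ΩD ∪ Γ.ΓD ×ˢ Ioo z₁ z₂ := fun hyA => by
    rw [indicator_of_mem hyA] at e0
    linarith
  have e6 : y ∉ Γ.ΓR ×ˢ Ioo z₁ z₂ := fun hyR => by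
    rw [indicator_of_mem hyR (fun y => a y.1)] at e0
    linarith [e2 hyR]
  rcases hy with hy | ⟨hy | hy, hyz⟩
  exacts [e5 (Or.inl hy), e5 (Or.inr ⟨hy, hyz⟩), e6 ⟨hy, hyz⟩]

/-- On test functions the indicator part of the weight contributes nothing. It can thus make the
weight nontrivial in the Friedrichs inequality at no cost, leaving only the Robin term. -/
theorem weightedInner_controlWeight {ΩD : Set Space} (hΩD : MeasurableSet ΩD)
    {X : DataSpace Ω z₁ z₂} (hX : X ∈ testData hΩ z₁ z₂ Γ ΩD) :
    weightedInner _ (memLp_controlWeight hΩ ha hΩD) (traceL X) (traceL X) = weightedInner _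
        (hΩ.memLp_top_lateral Γ.ΓR_subset Γ.measurableSet_ΓR ha) (traceL X) (traceL X) := by
  rw [weightedInner_apply, weightedInner_apply]
  refine integral_congr_ae ?_
  filter_upwards [(ae_restrict_iff' hΩD).1 hX.2.2, (ae_restrict_iff'
    (Γ.measurableSet_ΓD.prod measurableSet_Ioo)).1 hX.2.1.1] with y e1 e2
  by_cases hy : y ∈ ΩD ∪ Γ.ΓD ×ˢ Ioo z₁ z₂
  · have e3 : traceL X y = 0 := hy.elim e1 e2
    rw [e3, inner_zero_left, mul_zero, mul_zero]
  · rw [controlWeight, Pi.add_apply, indicator_of_notMem hy, zero_add]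

/-- The Friedrichs inequality on the space of test functions. -/
theorem exists_friedrichs_testData (hz : z₁ < z₂)
    (ha_pos : ∀ᵐ x ∂(Measure.hausdorffMeasure 1).restrict Γ.ΓR, 0 < a x)
    {ΩD : Set Space} (hΩD : MeasurableSet ΩD)
    (hcontrol : boundaryMeasure Ω z₁ z₂ (ΩD ∪ (Γ.ΓD ∪ Γ.ΓR) ×ˢ Ioo z₁ z₂) ≠ 0) :
    ∃ C : ℝ, 0 ≤ C ∧ ∀ X ∈ testData hΩ z₁ z₂ Γ ΩD, ‖valL X‖ ^ 2 + ‖traceL X‖ ^ 2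
      ≤ C * (‖gradL X‖ ^ 2 + ‖dzL X‖ ^ 2 + weightedInner _
        (hΩ.memLp_top_lateral Γ.ΓR_subset Γ.measurableSet_ΓR ha) (traceL X) (traceL X)) := by
  obtain ⟨C, hC0, hC⟩ := hΩ.cylinder_friedrichs hz (memLp_controlWeight hΩ ha hΩD)
    (ae_controlWeight_nonneg hΩ ΩD ha_pos) (controlWeight_not_ae_zero hΩ ha_pos hcontrol)
  refine ⟨C, hC0, fun X hX => ?_⟩
  rw [← weightedInner_controlWeight hΩ ha hΩD hX]
  exact hC X hX.1

/-- Diffusion bounds the derivatives from below, convection is nonnegative, and the Friedrichs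
inequality recovers the function and its trace from the derivatives and the Robin term. -/
theorem isCoercive_formL (hz : z₁ < z₂)
    (hc' : IsDiffusionCoefficient Ω c) (hσ' : IsDiffusionCoefficient Ω σ)
    (ha_pos : ∀ᵐ x ∂(Measure.hausdorffMeasure 1).restrict Γ.ΓR, 0 < a x)
    {ΩD : Set Space} (hΩD : MeasurableSet ΩD)
    (hin₁ : ∀ᵐ x ∂volume.restrict Ω, 0 < h x → (x, z₁) ∈ ΩD)
    (hin₂ : ∀ᵐ x ∂volume.restrict Ω, h x < 0 → (x, z₂) ∈ ΩD)
    (hcontrol : boundaryMeasure Ω z₁ z₂ (ΩD ∪ (Γ.ΓD ∪ Γ.ΓR) ×ˢ Ioo z₁ z₂) ≠ 0) :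
    ∃ δ : ℝ, 0 < δ ∧ ∀ X ∈ testData hΩ z₁ z₂ Γ ΩD,
      δ * ‖X‖ ^ 2 ≤ formL hΩ z₁ z₂ Γ hc hσ hh ha X X := by
  obtain ⟨C, hC0, hC⟩ := exists_friedrichs_testData hΩ ha hz ha_pos hΩD hcontrol
  obtain ⟨-, m₁, M₁, hm₁, hb₁⟩ := hc'
  obtain ⟨-, m₂, M₂, hm₂, hb₂⟩ := hσ'
  -- The `1` is there for the Robin term, which enters the form with coefficient one.
  set m := min 1 (min m₁ m₂) with hm
  have hm0 : 0 < m := by positivity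
  have l0 : m ≤ 1 := min_le_left _ _
  have l1 : m ≤ m₁ := (min_le_right _ _).trans (min_le_left _ _)
  have l2 : m ≤ m₂ := (min_le_right _ _).trans (min_le_right _ _)
  -- In `‖X‖ ^ 2` the derivatives count once and the remaining two components cost at most `C` times
  -- the controlled quantity, hence `1 + C`.
  refine ⟨m / (1 + C), by positivity, fun X hX => ?_⟩
  have k1 := weightedInner_self_ge (memLp_top_cylinder (z₁ := z₁) (z₂ := z₂) hc) (m := m)
    ((ae_cylinder hb₁).mono fun y hy => l1.trans hy.1) (dzL X)
  have k2 := weightedInner_self_ge (memLp_top_cylinder (z₁ := z₁) (z₂ := z₂) hσ) (m := m)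
    ((ae_cylinder hb₂).mono fun y hy => l2.trans hy.1) (gradL X)
  have k3 := convection_nonneg hΩ hh hz hΩD hin₁ hin₂ hX
  have k4 := hC X hX
  have k5 : 0 ≤ weightedInner _ (hΩ.memLp_top_lateral Γ.ΓR_subset Γ.measurableSet_ΓR ha)
      (traceL X) (traceL X) :=
    weightedInner_self_nonneg _ ((ae_robin_nonneg hΩ ha_pos).mono fun y hy => Or.inr hy)
  rw [formL_apply, norm_sq]
  set r := weightedInner _ (hΩ.memLp_top_lateral Γ.ΓR_subset Γ.measurableSet_ΓR ha)
    (traceL X) (traceL X)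
  have k6 : m * r ≤ r := mul_le_of_le_one_left k5 l0
  calc _ ≤ m / (1 + C) * ((1 + C) * (‖gradL X‖ ^ 2 + ‖dzL X‖ ^ 2 + r)) := by
        gcongr
        linarith
    _ = m * ‖gradL X‖ ^ 2 + m * ‖dzL X‖ ^ 2 + m * r := by
        field_simp
    _ ≤ _ := by linarith

end

/-! ### Lax–Milgram, existence and uniqueness -/

/-- The Lax–Milgram theorem for a form that is coercive on a closed subspace. -/
theorem exists_mem_forall_eq {V : Type*} [NormedAddCommGroup V] [InnerProductSpace ℝ V]
    [CompleteSpace V] {K : Submodule ℝ V} (hK : IsClosed (K : Set V)) (B : V →L[ℝ] V →L[ℝ] ℝ)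
    {δ : ℝ} (hδ : 0 < δ) (hB : ∀ X ∈ K, δ * ‖X‖ ^ 2 ≤ B X X) (l : V →L[ℝ] ℝ) :
    ∃ X ∈ K, ∀ Y ∈ K, B X Y = l Y := by
  have : CompleteSpace K := hK.completeSpace_coe
  let B' : K →L[ℝ] K →L[ℝ] ℝ := B.bilinearComp K.subtypeL K.subtypeL
  have hco : IsCoercive B' := ⟨δ, hδ, fun u => by
    have := hB u u.2
    rw [sq, ← mul_assoc] at this
    exact this⟩
  let f : K := (InnerProductSpace.toDual ℝ K).symm (l.comp K.subtypeL)
  let X : K := hco.continuousLinearEquivOfBilin.symm f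
  refine ⟨X, X.2, fun Y hY => ?_⟩
  have h1 := hco.continuousLinearEquivOfBilin_apply X ⟨Y, hY⟩
  rw [ContinuousLinearEquiv.apply_symm_apply] at h1
  have h2 : inner ℝ f (⟨Y, hY⟩ : K) = l Y := InnerProductSpace.toDual_symm_apply
  exact h1.symm.trans h2

end Graetz

theorem mainTheorem9
    (Ω : Set Graetz.Plane) (hΩ : Graetz.IsLipschitzDomain Ω)
    (z₁ z₂ : ℝ) (hz : z₁ < z₂)
    (c σ h a : Graetz.Plane → ℝ)
    (hc : Graetz.IsDiffusionCoefficient Ω c) (hσ : Graetz.IsDiffusionCoefficient Ω σ)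
    (hh : MemLp h ∞ (volume.restrict Ω))
    (Γ : Graetz.LateralPartition Ω)
    (ha : MemLp a ∞ ((Measure.hausdorffMeasure 1).restrict Γ.ΓR))
    (ha_pos : ∀ᵐ x ∂(Measure.hausdorffMeasure 1).restrict Γ.ΓR, 0 < a x)
    (ΩD ΩN : Set Graetz.Space) (hΩD : MeasurableSet ΩD) (hΩN : MeasurableSet ΩN)
    (hdisj : Disjoint ΩD ΩN) (hunion : ΩD ∪ ΩN = Ω ×ˢ {z₁, z₂})
    -- the flow enters only through the Dirichlet part of the inlet/outlet
    (hin₁ : ∀ᵐ x ∂volume.restrict Ω, 0 < h x → (x, z₁) ∈ ΩD)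
    (hin₂ : ∀ᵐ x ∂volume.restrict Ω, h x < 0 → (x, z₂) ∈ ΩD)
    -- not a pure Neumann/periodic problem, whose solutions are determined up to constants only
    (hcontrol : Graetz.boundaryMeasure Ω z₁ z₂ (ΩD ∪ (Γ.ΓD ∪ Γ.ΓR) ×ˢ Ioo z₁ z₂) ≠ 0)
    (TD SN : Graetz.Space → ℝ)
    (hTD : Graetz.IsDirichletDatum Γ z₁ z₂ ΩD TD)
    (hSN : MemLp SN 2 ((Graetz.boundaryMeasure Ω z₁ z₂).restrict ΩN)) :
    ∃ T : Graetz.H1 Ω z₁ z₂, Graetz.IsWeakSolution Γ ΩD ΩN c σ h a TD SN T ∧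
      ∀ T' : Graetz.H1 Ω z₁ z₂, Graetz.IsWeakSolution Γ ΩD ΩN c σ h a TD SN T' →
        T'.val =ᵐ[volume.restrict (Graetz.cylinder Ω z₁ z₂)] T.val := by
  open Graetz DataSpace in
  have mo : MeasurableSet (Ω ×ˢ {z₂}) := hΩ.isOpen.measurableSet.prod (measurableSet_singleton z₂)
  have mi : MeasurableSet (Ω ×ˢ {z₁}) := hΩ.isOpen.measurableSet.prod (measurableSet_singleton z₁)
  obtain ⟨l₂, hl₂⟩ := exists_load (hΩN.inter mo)
    (memLp_two_load (hΩ.memLp_top_outlet hz hc.memLp_top) mo hSN)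
  obtain ⟨l₁, hl₁⟩ := exists_load (hΩN.inter mi)
    (memLp_two_load (hΩ.memLp_top_inlet hz hc.memLp_top) mi hSN)
  obtain ⟨δ, hδ, hco⟩ := isCoercive_formL hΩ hc.memLp_top hσ.memLp_top hh ha hz hc hσ ha_pos hΩD
    hin₁ hin₂ hcontrol
  set B := formL hΩ z₁ z₂ Γ hc.memLp_top hσ.memLp_top hh ha with hB
  obtain ⟨G, g, hG, hGe⟩ := hTD
  obtain ⟨X₀, hX₀, hX₀r⟩ := hG.exists_data
  -- `X₀` lifts the Dirichlet datum; the correction `U` is sought among test functions, with the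
  -- form applied to `X₀` moved into the load.
  obtain ⟨U, hU, hUsol⟩ := exists_mem_forall_eq (isClosed_testData hΩ Γ ΩD) B hδ hco
    (l₂ - l₁ - B X₀)
  obtain ⟨X, hXU⟩ : ∃ X, X = X₀ + U := ⟨_, rfl⟩
  have hX : X ∈ traceData Ω z₁ z₂ := hXU ▸ add_mem hX₀ hU.1
  have htr : traceL X =ᵐ[boundaryMeasure Ω z₁ z₂] ⇑(traceL X₀) + ⇑(traceL U) := by
    rw [hXU, map_add]
    exact Lp.coeFn_add _ _
  have hsol : ∀ Y ∈ testData hΩ z₁ z₂ Γ ΩD, B X Y = l₂ Y - l₁ Y := by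
    intro Y hY
    have := hUsol Y hY
    rw [sub_apply, sub_apply] at this
    rw [hXU, map_add, add_apply, this]
    ring
  have hmem : ∀ {φ : H1 Ω z₁ z₂} {k : Space → ℝ} {Y : DataSpace Ω z₁ z₂},
      InAffineSpace Γ ΩD 0 φ k → Represents Y φ.val φ.grad φ.dz k → Y ∈ testData hΩ z₁ z₂ Γ ΩD :=
    fun hφ hY => ⟨hφ.1.mem_traceData hY, InAffineSpace.congr hΩ hφ.2 hY.trace.symm⟩
  have hXe := InAffineSpace.congr hΩ (g := traceL X₀ + traceL U) (TD := TD) (ΩD := ΩD) (Γ := Γ)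
    ⟨(hGe.1.congr hΩ hX₀r.trace.symm).add hU.2.1, by
      filter_upwards [hGe.2, hU.2.2, ae_restrict_of_ae hX₀r.trace] with y e1 e2 e3
      simp [e1, e2, e3]⟩ htr.symm
  refine ⟨H1.ofData hX, ⟨traceL X, ⟨hasTrace_ofData hX, hXe⟩, ?_⟩, ?_⟩
  · intro φ k hφ
    obtain ⟨Y, -, hY⟩ := hφ.1.exists_data
    rw [form_eq_formL hΩ hc.memLp_top hσ.memLp_top hh ha (represents_self X) hY,
      ← hl₂ Y k hY.trace, ← hl₁ Y k hY.trace]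
    exact hsol Y (hmem hφ hY)
  · rintro T' ⟨g', ⟨hT', hT'e⟩, hT's⟩
    obtain ⟨X', hX', hX'r⟩ := hT'.exists_data
    obtain ⟨D, hD⟩ : ∃ D, D = X' + (-1 : ℝ) • X := ⟨_, rfl⟩
    have hdiff : D ∈ testData hΩ z₁ z₂ Γ ΩD := by
      refine ⟨hD ▸ add_mem hX' (Submodule.smul_mem _ _ hX), InAffineSpace.congr hΩ
        (g := g' + (-1 : ℝ) • ⇑(traceL X)) ⟨hT'e.1.add (hXe.1.smul _), ?_⟩ ?_⟩
      · filter_upwards [hT'e.2, hXe.2] with y e1 e2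
        simp [e1, e2]
      · exact hD ▸ (hX'r.add ((represents_self X).smul (-1))).trace.symm
    -- The difference of the two solutions is itself a test function; testing both equations with it
    -- makes the form vanish on it, and coercivity gives `D = 0`.
    have h1 := hT's (H1.ofData hdiff.1) (traceL D) ⟨hasTrace_ofData hdiff.1, hdiff.2⟩
    rw [form_eq_formL hΩ hc.memLp_top hσ.memLp_top hh ha hX'r (represents_self D),
      ← hl₂ D _ EventuallyEq.rfl, ← hl₁ D _ EventuallyEq.rfl] at h1
    have h2 : B D D = 0 := by
      have hBD : B D = B X' + (-1 : ℝ) • B X := by rw [hD, map_add, map_smul]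
      rw [hBD, add_apply, smul_apply, hsol D hdiff, hB, h1]
      simp
    have h3 := hco D hdiff
    rw [h2] at h3
    have h4 : D = 0 := by
      have : ‖D‖ ^ 2 ≤ 0 := by nlinarith
      exact norm_eq_zero.1 (pow_eq_zero_iff two_ne_zero |>.1 (le_antisymm this (sq_nonneg _)))
    have h5 : X' = X := by
      rw [hD, neg_one_smul, add_neg_eq_zero] at h4
      exact h4
    rw [h5] at hX'r
    exact hX'r.val.symm
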